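/- Let $S^1\subset\mathbb R^2$ and $S^3\subset\mathbb R^4$ be the unit spheres with the metrics $g_{S^1}=dx^2$ ($x$ the arc length coordinate) and $g_{S^3}$ induced from the Euclidean metrics, and let $g=dx^2+g_{S^3}$ be the product metric on the 4-manifold $S^1\times S^3$ (pullbacks under the projections are omitted from the notation). Then: (1) $g$ is locally conformally flat: every point has an open neighbourhood $U$ and a strictly positive smooth function $f$ on $U$ such that $fg$ has zero sectional curvature everywhere on $U$. (2) $S^1\times S^3$ is orientable, and for every orientation $g$ is self-dual: the component $W_-\colon\Lambda^2_-\to\Lambda^2_-$ of the Weyl tensor $W$, acting as an operator on 2-forms, vanishes identically, where $\Lambda^2_-$ is the $(-1)$-eigenspace of the Hodge star on 2-forms. (3) The $(0,4)$ Riemann curvature tensor of $g$, with the sign convention $\mathrm{Rm}(X,Y,Z,T)=g(R(X,Y)T,Z)$, $R(X,Y)=[\nabla_X,\nabla_Y]-\nabla_{[X,Y]}$ (so that $\mathrm{Rm}(X,Y,X,Y)$ is positive on round spheres), is $$\mathrm{Rm}=g\odot \tfrac12\,(g_{S^3}-dx^2),$$ where $\odot$ is the Kulkarni--Nomizu product $$(A\odot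 B)(X,Y,Z,T)=\begin{vmatrix}A(X,Z)&B(X,T)\\A(Y,Z)&B(Y,T)\end{vmatrix}+\begin{vmatrix}B(X,Z)&A(X,T)\\B(Y,Z)&A(Y,T)\end{vmatrix}.$$ (4) The Weyl tensor of $g$ vanishes identically, that is, with $\mathrm{Ric}$ and $s$ the Ricci and scalar curvatures of $g$ and $n=4$, $$W=\mathrm{Rm}-\tfrac{s}{2n(n-1)}\,g\odot g-\tfrac1{n-2}\bigl(\mathrm{Ric}-\tfrac sn g\bigr)\odot g=0.$$ -/

import Mathlib

open Set Metric Module Topology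
open Bundle (Trivialization TotalSpace)
open scoped Manifold ContDiff

set_option linter.unusedSectionVars false

noncomputable section

/-! ### Multilinear algebra on a finite-dimensional real vector space -/

section Algebra

variable {V : Type*} [AddCommGroup V] [Module ℝ V]

/-- The Kulkarni-Nomizu product of two symmetric bilinear forms. -/
def kulkarniNomizu (A B : V → V → ℝ) (X Y Z T : V) : ℝ :=
  Matrix.det !![A X Z, B X T; A Y Z, B Y T] + Matrix.det !![B X Z, A X T; B Y Z, A Y T]

variable [FiniteDimensional ℝ V]

/-- The matrix `g^{ij}`, inverse to the matrix `g_{ij} = g(b_i, b_j)`, in a fixed basis `b`. -/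
def inverseGram (g : V → V → ℝ) : Matrix (Fin (finrank ℝ V)) (Fin (finrank ℝ V)) ℝ :=
  (Matrix.of fun i j => g (finBasis ℝ V i) (finBasis ℝ V j))⁻¹

/-- The trace `g^{ij} h_{ij}` of a bilinear form `h` with respect to `g`. -/
def metricTrace (g h : V → V → ℝ) : ℝ :=
  ∑ i, ∑ j, inverseGram g i j * h (finBasis ℝ V i) (finBasis ℝ V j)

/-- The Ricci contraction `Ric(X, Y) = g^{ij} R(b_i, X, b_j, Y)` of a curvature-like tensor. -/
def ricciContraction (g : V → V → ℝ) (R : V → V → V → V → ℝ) (X Y : V) : ℝ :=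
  metricTrace g (fun u v => R u X v Y)

/-- The scalar curvature of a curvature-like tensor. -/
def scalarContraction (g : V → V → ℝ) (R : V → V → V → V → ℝ) : ℝ :=
  metricTrace g (ricciContraction g R)

/-- The trace-free part `Ric - (s / n) g` of the Ricci contraction. -/
def traceFreeRicci (g : V → V → ℝ) (R : V → V → V → V → ℝ) (X Y : V) : ℝ :=
  ricciContraction g R X Y - scalarContraction g R / finrank ℝ V * g X Y

/-- The Weyl part `W = R - U - Z` of a curvature-like tensor in dimension `n ≥ 3`, where
`U = s / (2 n (n - 1)) g ⊚ g` and `Z = 1 / (n - 2) Ric₀ ⊚ g`. -/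
def weylPart (g : V → V → ℝ) (R : V → V → V → V → ℝ) (X Y Z T : V) : ℝ :=
  R X Y Z T
    - scalarContraction g R / (2 * (finrank ℝ V : ℝ) * ((finrank ℝ V : ℝ) - 1))
        * kulkarniNomizu g g X Y Z T
    - 1 / ((finrank ℝ V : ℝ) - 2) * kulkarniNomizu (traceFreeRicci g R) g X Y Z T

/-- The inner product `⟨α, β⟩ = (1 / 2) g^{ik} g^{jl} α_{ij} β_{kl}` on 2-forms, for which the
forms `e^i ∧ e^j`, `i < j`, are orthonormal when `e` is an orthonormal basis. -/
def formInner (g α β : V → V → ℝ) : ℝ :=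
  1 / 2 * ∑ i, ∑ j, ∑ k, ∑ l, inverseGram g i k * inverseGram g j l *
    α (finBasis ℝ V i) (finBasis ℝ V j) * β (finBasis ℝ V k) (finBasis ℝ V l)

/-- A curvature-like tensor as an operator on 2-forms: `(Wα)_{ij} = (1 / 2) W_{ij}^{kl} α_{kl}`. -/
def curvatureOperator (g : V → V → ℝ) (W : V → V → V → V → ℝ) (α : V → V → ℝ) (X Y : V) : ℝ :=
  formInner g (W X Y) α

/-- The wedge product of two 2-forms. -/
def wedgeTwo (α β : V [⋀^Fin 2]→ₗ[ℝ] ℝ) (a b c d : V) : ℝ :=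
  α ![a, b] * β ![c, d] - α ![a, c] * β ![b, d] + α ![a, d] * β ![b, c]
    + α ![b, c] * β ![a, d] - α ![b, d] * β ![a, c] + α ![c, d] * β ![a, b]

/-- The volume form `√det(g_{ij}) e^1 ∧ e^2 ∧ e^3 ∧ e^4`, `e` a positively oriented basis. -/
def volumeFormFour [Fact (finrank ℝ V = 4)] (g : V → V → ℝ) (o : Orientation ℝ V (Fin 4)) :
    V [⋀^Fin 4]→ₗ[ℝ] ℝ :=
  let e := o.someBasis (by simp [(Fact.out : finrank ℝ V = 4)])
  √(Matrix.of fun i j => g (e i) (e j)).det • e.det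

/-- `β' = *β`, i.e. `⟨α, β⟩ ω_g = α ∧ β'` for every 2-form `α`. -/
def IsHodgeStar [Fact (finrank ℝ V = 4)] (g : V → V → ℝ) (o : Orientation ℝ V (Fin 4))
    (β β' : V [⋀^Fin 2]→ₗ[ℝ] ℝ) : Prop :=
  ∀ (α : V [⋀^Fin 2]→ₗ[ℝ] ℝ) (a b c d : V),
    formInner g (fun u v => α ![u, v]) (fun u v => β ![u, v]) * volumeFormFour g o ![a, b, c, d]
      = wedgeTwo α β' a b c d

/-- The space `Λ²_-` of 2-forms `β` with `*β = -β`. -/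
def antiSelfDualForms [Fact (finrank ℝ V = 4)] (g : V → V → ℝ) (o : Orientation ℝ V (Fin 4)) :
    Set (V [⋀^Fin 2]→ₗ[ℝ] ℝ) :=
  {β | IsHodgeStar g o β (-β)}

/-- `v` is a positively oriented basis. -/
def IsPositiveFrame (o : Orientation ℝ V (Fin 4)) (v : Fin 4 → V) : Prop :=
  ∃ b : Basis (Fin 4) ℝ V, ⇑b = v ∧ b.orientation = o

end Algebra

/-! ### Curvature of a metric on a vector space -/

section Local

variable {E : Type*} [NormedAddCommGroup E] [NormedSpace ℝ E] [FiniteDimensional ℝ E]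

/-- The Christoffel symbols `Γ^k_{ij} = (1 / 2) g^{kl} (∂_i g_{jl} + ∂_j g_{il} - ∂_l g_{ij})` of
the Levi-Civita connection at `y`, as the bilinear map `(u, v) ↦ ∇_u v` for constant vector
fields `u`, `v`. -/
def christoffel (G : E → E →L[ℝ] E →L[ℝ] ℝ) (y u v : E) : E :=
  ∑ k, ∑ l, (1 / 2 * inverseGram (fun a b => G y a b) k l *
    (fderiv ℝ G y u v (finBasis ℝ E l) + fderiv ℝ G y v u (finBasis ℝ E l)
      - fderiv ℝ G y (finBasis ℝ E l) u v)) • finBasis ℝ E k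

/-- The curvature `R(u, v) w = ∇_u ∇_v w - ∇_v ∇_u w` at `y`, for constant vector fields
`u`, `v`, `w` (so that `[u, v] = 0`). -/
def curvatureEndo (G : E → E →L[ℝ] E →L[ℝ] ℝ) (y u v w : E) : E :=
  fderiv ℝ (fun z => christoffel G z v w) y u + christoffel G y u (christoffel G y v w)
    - (fderiv ℝ (fun z => christoffel G z u w) y v + christoffel G y v (christoffel G y u w))

end Local

/-! ### Tensor fields on manifolds -/

section Manifold

variable {E : Type*} [NormedAddCommGroup E] [NormedSpace ℝ E]
  {H : Type*} [TopologicalSpace H] {I : ModelWithCorners ℝ E H}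
  {M : Type*} [TopologicalSpace M] [ChartedSpace H M]
  {F : Type*} [NormedAddCommGroup F] [NormedSpace ℝ F]
  {K : Type*} [TopologicalSpace K] {J : ModelWithCorners ℝ F K}
  {N : Type*} [TopologicalSpace N] [ChartedSpace K N]

/-- A field of bilinear forms on the tangent spaces of a manifold (without regularity). -/
abbrev TwoTensorField (I : ModelWithCorners ℝ E H) (M : Type*) [TopologicalSpace M]
    [ChartedSpace H M] : Type _ :=
  ∀ x : M, TangentSpace I x →L[ℝ] TangentSpace I x →L[ℝ] ℝ

/-- The pullback `f^* h`. -/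
def pullbackTensor (f : M → N) (h : TwoTensorField J N) : TwoTensorField I M := fun x =>
  (ContinuousLinearMap.precomp ℝ (mfderiv I J f x)) ∘L (h (f x)) ∘L (mfderiv I J f x)

lemma pullbackTensor_apply (f : M → N) (h : TwoTensorField J N) (x : M)
    (v w : TangentSpace I x) :
    pullbackTensor (I := I) f h x v w = h (f x) (mfderiv I J f x v) (mfderiv I J f x w) := rfl

instance tangentSpaceFiniteDimensional [FiniteDimensional ℝ E] (x : M) :
    FiniteDimensional ℝ (TangentSpace I x) :=
  inferInstanceAs (FiniteDimensional ℝ E)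

instance tangentSpaceFactFinrank [h : Fact (finrank ℝ E = 4)] (x : M) :
    Fact (finrank ℝ (TangentSpace I x) = 4) := h

/-- The `(0,4)` Riemann curvature tensor of `g` at `x`, with the sign convention for which
`Rm(X, Y, X, Y) > 0` on round spheres: `Rm(X, Y, Z, T) = g(R(X, Y) T, Z)`.
It is computed in the preferred chart at `x`, through which `TangentSpace I x` is identified
with `E`. It only depends on the germ of `g` at `x`. -/
def riemannTensor [FiniteDimensional ℝ E] [I.Boundaryless] (g : TwoTensorField I M) (x : M)
    (X Y Z T : TangentSpace I x) : ℝ :=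
  g x (curvatureEndo (E := E) (pullbackTensor (I := 𝓘(ℝ, E)) (extChartAt I x).symm g)
    (extChartAt I x x) X Y T) Z

/-- The sectional curvature of the plane spanned by the linearly independent vectors `u`, `v`. -/
def sectionalCurvature [FiniteDimensional ℝ E] [I.Boundaryless] (g : TwoTensorField I M) (x : M)
    (u v : TangentSpace I x) : ℝ :=
  riemannTensor g x u v u v / (g x u u * g x v v - g x u v ^ 2)

/-- The Weyl tensor of `g` at `x`. -/
def weylTensor [FiniteDimensional ℝ E] [I.Boundaryless] (g : TwoTensorField I M) (x : M)
    (X Y Z T : TangentSpace I x) : ℝ :=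
  weylPart (fun u v => g x u v) (riemannTensor g x) X Y Z T

/-- An orientation of a 4-manifold: a choice of orientations of the tangent spaces which is
locally constant in charts (`T_p M` is identified with `E` by the preferred chart at `p`). -/
def IsManifoldOrientation [FiniteDimensional ℝ E]
    (o : ∀ x : M, Orientation ℝ (TangentSpace I x) (Fin 4)) : Prop :=
  ∀ p : M, ∀ᶠ x in 𝓝 p, ∀ w : Fin 4 → TangentSpace I x,
    IsPositiveFrame (o x) w ↔
      IsPositiveFrame (o p) (fun i => mfderiv I 𝓘(ℝ, E) (extChartAt I p) x (w i))

/-- A field of bilinear forms which is smooth as a section of the bundle of bilinear forms. -/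
def IsSmoothTensor [IsManifold I ∞ M] (h : TwoTensorField I M) : Prop :=
  ContMDiff I (I.prod 𝓘(ℝ, E →L[ℝ] E →L[ℝ] ℝ)) ∞
    (fun b => TotalSpace.mk' (E →L[ℝ] E →L[ℝ] ℝ)
      (E := fun b : M => TangentSpace I b →L[ℝ] TangentSpace I b →L[ℝ] ℝ) b (h b))

/-- Smooth Riemannian metrics on a manifold. -/
abbrev SmoothMetric (I : ModelWithCorners ℝ E H) (M : Type*) [TopologicalSpace M]
    [ChartedSpace H M] [IsManifold I ∞ M] : Type _ :=
  Bundle.ContMDiffRiemannianMetric I ∞ E (fun x : M => TangentSpace I x)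

/-- Every point has a neighbourhood `U` with a strictly positive smooth function `f` such that
`f g` has zero sectional curvature everywhere on `U`. -/
def IsLocallyConformallyFlat [FiniteDimensional ℝ E] [I.Boundaryless] [IsManifold I ∞ M]
    (g : SmoothMetric I M) : Prop :=
  ∀ p : M, ∃ U : Set M, IsOpen U ∧ p ∈ U ∧ ∃ f : M → ℝ,
    ContMDiffOn I 𝓘(ℝ) ∞ f U ∧ (∀ x ∈ U, 0 < f x) ∧
    ∀ x ∈ U, ∀ u v : TangentSpace I x, LinearIndependent ℝ ![u, v] →
      sectionalCurvature (fun y => f y • g.inner y) x u v = 0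

/-- Self-duality `W_- = 0` of a metric on an oriented 4-manifold: the component
`Λ²_- → Λ²_-` of the Weyl operator vanishes at every point. -/
def IsSelfDual [FiniteDimensional ℝ E] [I.Boundaryless] [IsManifold I ∞ M]
    [Fact (finrank ℝ E = 4)] (g : SmoothMetric I M)
    (o : ∀ x : M, Orientation ℝ (TangentSpace I x) (Fin 4)) : Prop :=
  ∀ x : M, ∀ α ∈ antiSelfDualForms (fun u v => g.inner x u v) (o x),
    ∀ β ∈ antiSelfDualForms (fun u v => g.inner x u v) (o x),
      formInner (fun u v => g.inner x u v)
        (curvatureOperator (fun u v => g.inner x u v) (weylTensor g.inner x)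
          (fun u v => α ![u, v]))
        (fun u v => β ![u, v]) = 0

/-! Smoothness of pullbacks and sums, needed to construct metrics. -/

lemma contDiff_flip : ContDiff ℝ ∞ (fun L : E →L[ℝ] F →L[ℝ] ℝ => L.flip) :=
  ContinuousLinearMap.contDiff (𝕜 := ℝ) (E := E →L[ℝ] F →L[ℝ] ℝ) (F := F →L[ℝ] E →L[ℝ] ℝ)
    (ContinuousLinearMap.flipₗᵢ ℝ E F ℝ).toContinuousLinearEquiv.toContinuousLinearMap

lemma contDiff_bilinearComp :
    ContDiff ℝ ∞ (fun p : (F →L[ℝ] F →L[ℝ] ℝ) × (E →L[ℝ] F) => p.1.bilinearComp p.2 p.2) :=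
  contDiff_flip.comp
    ((contDiff_flip.comp (contDiff_fst.clm_comp contDiff_snd)).clm_comp contDiff_snd)

open ContinuousLinearMap in
lemma IsSmoothTensor.pullback [IsManifold I ∞ M] [IsManifold J ∞ N] {f : M → N}
    (hf : ContMDiff I J ∞ f) {h : TwoTensorField J N} (hh : IsSmoothTensor h) :
    IsSmoothTensor (pullbackTensor (I := I) f h) := by
  intro x₀
  have hA := ContMDiffAt.mfderiv_const (m := ∞) (hf x₀) (by simp)
  have hB := ((contMDiffAt_hom_bundle _).1 (hh (f x₀))).2
  have hB' := ContMDiffAt.comp x₀ hB (hf x₀)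
  rw [contMDiffAt_hom_bundle]
  refine ⟨contMDiffAt_id, ?_⟩
  have key := (contDiff_bilinearComp (E := E) (F := F)).contMDiff.contMDiffAt.comp x₀
    (hB'.prodMk_space hA)
  refine key.congr_of_eventuallyEq ?_
  have h1 : ∀ᶠ x in 𝓝 x₀, x ∈ (trivializationAt E (TangentSpace I) x₀).baseSet :=
    (trivializationAt E (TangentSpace I) x₀).open_baseSet.mem_nhds
      (FiberBundle.mem_baseSet_trivializationAt' x₀)
  have h2 : ∀ᶠ x in 𝓝 x₀, f x ∈ (trivializationAt F (TangentSpace J) (f x₀)).baseSet :=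
    (hf x₀).continuousAt.preimage_mem_nhds
     ((trivializationAt F (TangentSpace J) (f x₀)).open_baseSet.mem_nhds
      (FiberBundle.mem_baseSet_trivializationAt' (f x₀)))
  filter_upwards [h1, h2] with x hx hy
  ext v w
  rw [inCoordinates_apply_eq₂ hx hx (Set.mem_univ _)]
  simp only [Function.comp_apply, ContinuousLinearMap.bilinearComp_apply]
  rw [inCoordinates_apply_eq₂ hy hy (Set.mem_univ _)]
  have hs : ∀ u : E, (trivializationAt F (TangentSpace J) (f x₀)).symm (f x)
      (inTangentCoordinates I J id f (fun x => mfderiv I J f x) x₀ x u) =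
      mfderiv I J f x ((trivializationAt E (TangentSpace I) x₀).symm x u) := by
    intro u
    unfold inTangentCoordinates ContinuousLinearMap.inCoordinates
    simp only [ContinuousLinearMap.comp_apply,
      Trivialization.continuousLinearMapAt_apply, id]
    refine (Trivialization.symm_linearMapAt (R := ℝ) _ hy _).trans ?_
    exact congrArg _ (Trivialization.symmL_apply _ hx u)
  rw [hs, hs]
  rfl

lemma IsSmoothTensor.add [IsManifold I ∞ M] {h k : TwoTensorField I M} (hh : IsSmoothTensor h)
    (hk : IsSmoothTensor k) : IsSmoothTensor (fun x => h x + k x) :=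
  ContMDiff.add_section (F := E →L[ℝ] E →L[ℝ] ℝ)
    (V := fun b : M => TangentSpace I b →L[ℝ] TangentSpace I b →L[ℝ] ℝ) hh hk

end Manifold

/-! ### Product metrics and round spheres -/

section Metrics

lemma isVonNBounded_of_pos {E : Type*} [NormedAddCommGroup E] [NormedSpace ℝ E]
    [FiniteDimensional ℝ E] (b : E →L[ℝ] E →L[ℝ] ℝ) (pos : ∀ v, v ≠ 0 → 0 < b v v) :
    Bornology.IsVonNBounded ℝ {v : E | b v v < 1} := by
  obtain ⟨c, hc, h⟩ : ∃ c > 0, ∀ v, c * ‖v‖ ^ 2 ≤ b v v := by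
    have : ProperSpace E := FiniteDimensional.proper ℝ E
    rcases (sphere (0 : E) 1).eq_empty_or_nonempty with he | hne
    · refine ⟨1, one_pos, fun v => ?_⟩
      by_cases hv : v = 0
      · simp [hv]
      · exact absurd (show (‖v‖⁻¹ • v) ∈ sphere (0 : E) 1 by simp [norm_smul, hv]) (by simp [he])
    · obtain ⟨m, hm, hmin⟩ := (isCompact_sphere (0 : E) 1).exists_isMinOn hne
        (f := fun v => b v v) (by fun_prop)
      have hm0 : m ≠ 0 := by rintro rfl; simp at hm
      refine ⟨b m m, pos m hm0, fun v => ?_⟩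
      by_cases hv : v = 0
      · simp [hv]
      · have h1 : b m m ≤ b (‖v‖⁻¹ • v) (‖v‖⁻¹ • v) :=
          hmin (show (‖v‖⁻¹ • v) ∈ sphere (0 : E) 1 by simp [norm_smul, hv])
        simp only [map_smul, smul_apply, smul_eq_mul] at h1
        have hn : 0 < ‖v‖ := norm_pos_iff.2 hv
        calc b m m * ‖v‖ ^ 2 ≤ (‖v‖⁻¹ * (‖v‖⁻¹ * b v v)) * ‖v‖ ^ 2 := by gcongr
          _ = b v v := by field_simp
  rw [NormedSpace.isVonNBounded_iff, isBounded_iff_forall_norm_le]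
  refine ⟨√(1 / c), fun v hv => ?_⟩
  apply Real.le_sqrt_of_sq_le
  rw [le_div_iff₀ hc, mul_comm]
  exact (h v).trans (le_of_lt hv)

variable {E : Type*} [NormedAddCommGroup E] [NormedSpace ℝ E]
  {H : Type*} [TopologicalSpace H] {I : ModelWithCorners ℝ E H}
  {M : Type*} [TopologicalSpace M] [ChartedSpace H M]
  {F : Type*} [NormedAddCommGroup F] [NormedSpace ℝ F]
  {K : Type*} [TopologicalSpace K] {J : ModelWithCorners ℝ F K}
  {N : Type*} [TopologicalSpace N] [ChartedSpace K N]

/-- The bilinear form field `π₁^* g + π₂^* h` on a product. -/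
def prodTensor (g : TwoTensorField I M) (h : TwoTensorField J N) :
    TwoTensorField (I.prod J) (M × N) := fun x =>
  pullbackTensor (I := I.prod J) Prod.fst g x + pullbackTensor (I := I.prod J) Prod.snd h x

lemma prodTensor_apply (g : TwoTensorField I M) (h : TwoTensorField J N) (x : M × N)
    (v w : TangentSpace (I.prod J) x) :
    prodTensor g h x v w = g x.1 (v : E × F).1 (w : E × F).1
      + h x.2 (v : E × F).2 (w : E × F).2 := by
  simp only [prodTensor, add_apply, pullbackTensor_apply]
  rw [mfderiv_fst, mfderiv_snd]
  rfl

lemma prodTensor_pos [IsManifold I ∞ M] [IsManifold J ∞ N]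
    (g : SmoothMetric I M) (h : SmoothMetric J N) (x : M × N)
    (v : TangentSpace (I.prod J) x) (hv : v ≠ 0) :
    0 < prodTensor g.inner h.inner x v v := by
  have hg : ∀ u : E, 0 ≤ g.inner x.1 u u := fun u => by
    by_cases hu : u = 0
    · subst hu; exact le_of_eq (map_zero (g.inner x.1 (0 : E))).symm
    · exact (g.pos x.1 u hu).le
  have hh : ∀ u : F, 0 ≤ h.inner x.2 u u := fun u => by
    by_cases hu : u = 0
    · subst hu; exact le_of_eq (map_zero (h.inner x.2 (0 : F))).symm
    · exact (h.pos x.2 u hu).le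
  rw [prodTensor_apply]
  by_cases h1 : (v : E × F).1 = 0
  · have h2 : (v : E × F).2 ≠ 0 := fun h2 => hv (Prod.ext h1 h2)
    exact add_pos_of_nonneg_of_pos (hg _) (h.pos x.2 _ h2)
  · exact add_pos_of_pos_of_nonneg (g.pos x.1 _ h1) (hh _)

/-- The product of two Riemannian metrics. -/
def prodMetric [FiniteDimensional ℝ E] [FiniteDimensional ℝ F] [IsManifold I ∞ M]
    [IsManifold J ∞ N] (g : SmoothMetric I M) (h : SmoothMetric J N) :
    SmoothMetric (I.prod J) (M × N) where
  inner := prodTensor g.inner h.inner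
  symm x v w := by
    rw [prodTensor_apply, prodTensor_apply]
    exact congrArg₂ (· + ·) (g.symm x.1 _ _) (h.symm x.2 _ _)
  pos := prodTensor_pos g h
  isVonNBounded x := isVonNBounded_of_pos (E := E × F) _ (prodTensor_pos g h x)
  contMDiff := IsSmoothTensor.add (IsSmoothTensor.pullback contMDiff_fst g.contMDiff)
    (IsSmoothTensor.pullback contMDiff_snd h.contMDiff)

/-- The flat metric of an inner product space, as a field of bilinear forms. -/
def euclideanTensor (V : Type*) [NormedAddCommGroup V] [InnerProductSpace ℝ V] :
    TwoTensorField 𝓘(ℝ, V) V := fun _ => innerSL ℝ (E := V)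

lemma isSmoothTensor_euclideanTensor (V : Type*) [NormedAddCommGroup V] [InnerProductSpace ℝ V] :
    IsSmoothTensor (euclideanTensor V) := by
  intro x
  rw [contMDiffAt_hom_bundle]
  refine ⟨contMDiffAt_id, ?_⟩
  let L : V →L[ℝ] V →L[ℝ] ℝ := innerSL ℝ
  refine (contMDiffAt_const (c := L)).congr_of_eventuallyEq ?_
  filter_upwards with y
  ext v w
  have hy : y ∈ (trivializationAt V (TangentSpace 𝓘(ℝ, V)) x).baseSet := by
    simp [chartAt_self_eq]
  have hs : ∀ u : V, (trivializationAt V (TangentSpace 𝓘(ℝ, V)) x).symm y u = u := fun u =>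
    (Trivialization.symmL_apply (R := ℝ) _ hy u).symm.trans
      (congrArg (fun T : V →L[ℝ] V => T u) (TangentBundle.symmL_model_space x y))
  rw [inCoordinates_apply_eq₂ hy hy (Set.mem_univ _), hs, hs]
  simp only [Bundle.Trivial.fiberBundle_trivializationAt', Bundle.Trivial.linearMapAt_trivialization]
  rfl

/-- The unit sphere `S^n` in `ℝ^{n+1}`. -/
abbrev Sph (n : ℕ) : Type := sphere (0 : EuclideanSpace ℝ (Fin (n + 1))) 1

/-- The inclusion of `S^n` in `ℝ^{n+1}`. -/
def Sph.incl (n : ℕ) : Sph n → EuclideanSpace ℝ (Fin (n + 1)) := Subtype.val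

lemma Sph.incl_contMDiff (n : ℕ) :
    ContMDiff (𝓡 n) 𝓘(ℝ, EuclideanSpace ℝ (Fin (n + 1))) ∞ (Sph.incl n) := by
  have := Fact.mk (@finrank_euclideanSpace_fin ℝ _ (n + 1))
  exact contMDiff_coe_sphere

lemma Sph.mfderiv_incl_injective (n : ℕ) (x : Sph n) :
    Function.Injective (mfderiv (𝓡 n) 𝓘(ℝ, EuclideanSpace ℝ (Fin (n + 1))) (Sph.incl n) x) := by
  have := Fact.mk (@finrank_euclideanSpace_fin ℝ _ (n + 1))
  convert! injective_mvfderiv_subtypeVal_sphere x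

lemma roundTensor_pos (n : ℕ) (x : Sph n) (v : TangentSpace (𝓡 n) x) (hv : v ≠ 0) :
    0 < pullbackTensor (I := 𝓡 n) (Sph.incl n) (euclideanTensor _) x v v := by
  have h := (map_ne_zero_iff _ (Sph.mfderiv_incl_injective n x)).2 hv
  exact real_inner_self_pos (F := EuclideanSpace ℝ (Fin (n + 1))).2 h

/-- The standard metric of `S^n`, induced from the Euclidean metric of `ℝ^{n+1}`. -/
def roundMetric (n : ℕ) : SmoothMetric (𝓡 n) (Sph n) where
  inner := pullbackTensor (Sph.incl n) (euclideanTensor _)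
  symm _ _ _ := real_inner_comm (F := EuclideanSpace ℝ (Fin (n + 1))) _ _
  pos := roundTensor_pos n
  isVonNBounded x := isVonNBounded_of_pos (E := EuclideanSpace ℝ (Fin n)) _ (roundTensor_pos n x)
  contMDiff := IsSmoothTensor.pullback (Sph.incl_contMDiff n) (isSmoothTensor_euclideanTensor _)
end Metrics

instance factFinrankS1S3 :
    Fact (finrank ℝ (EuclideanSpace ℝ (Fin 1) × EuclideanSpace ℝ (Fin 3)) = 4) :=
  ⟨by simp⟩

/-- The standard product metric on `S^1 × S^3`. -/
def metricS1S3 : SmoothMetric ((𝓡 1).prod (𝓡 3)) (Sph 1 × Sph 3) :=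
  prodMetric (roundMetric 1) (roundMetric 3)

/-- The pullback to `S^1 × S^3` of the metric `dx²` of `S^1`, `x` the arc length coordinate. -/
def dxSquared : TwoTensorField ((𝓡 1).prod (𝓡 3)) (Sph 1 × Sph 3) :=
  pullbackTensor Prod.fst (roundMetric 1).inner

/-- The pullback to `S^1 × S^3` of the metric of `S^3`. -/
def tensorS3 : TwoTensorField ((𝓡 1).prod (𝓡 3)) (Sph 1 × Sph 3) :=
  pullbackTensor Prod.snd (roundMetric 3).inner

end

/-!
# The product metric on `S¹ × S³`

All curvature tensors at `x` are computed at the origin of the product of the two stereographic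
charts from the antipodes of the components of `x`. There the metric is
`k(a)² |da|² + k(b)² |db|²` with `k = stereoFactor`, `k(a) = 4 / (|a|² + 4)`
(`pullbackTensor_prodMetric_roundMetric`). The Koszul formula (`christoffel_eq_of_koszul`) gives the
Christoffel symbols of this metric and of its rescalings by a function `F` with
`dF = 2 F k(a) ⟨e, da⟩` in closed form (`christoffel_modelMetric`): `F` itself drops out, only `e`
remains. Since `k(0) = 1` and `dk(0) = 0`, the curvature at the origin follows
(`curvatureEndo_modelMetric`).

* For `e = 0` it is the curvature of the three-dimensional factor, because a line has none
  (`curvatureEndo_modelMetric_const`). With `g = dx² + g_{S³}` it equals `(1/2) g_{S³} ⊚ g_{S³}`, and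
  this is `g ⊚ (1/2) (g_{S³} - dx²)` because `dx² ⊚ dx² = 0`. Its contractions in an orthonormal basis
  (`metricTrace_eq_sum`) are `Ric = 2 g_{S³}` and `s = 6`, whence `W = 0` (`weylPart_cylinder`) and
  in particular `W₋ = 0`.
* For `e` a unit vector of the line it vanishes (`curvatureEndo_modelMetric_exp`). The conformal
  factor `e^{2t}`, where `t` is the arc length on an arc of the circle, satisfies the differential
  equation with such an `e`; it is realized as `exp (2 arg (z / p))`, `z` ranging over the circle in `ℂ`
  (`expTwoAngle`). This is the flat metric of `ℝ⁴ ∖ 0` in polar coordinates.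

For orientability, the outward normals of the two factors frame the normal bundle of
`S¹ × S³ ⊂ ℝ² × ℝ⁴`, and the contraction of a volume form of `ℝ⁶` with them is a volume form
(`exists_isManifoldOrientation_of_transverse_frame`).
-/

set_option maxSynthPendingDepth 3

/-! ### Gram matrices and traces -/

section Gram

variable {V : Type*} [AddCommGroup V] [Module ℝ V] [FiniteDimensional ℝ V]

lemma isUnit_det_gram {B : V →ₗ[ℝ] V →ₗ[ℝ] ℝ} (pos : ∀ v, v ≠ 0 → 0 < B v v) :
    IsUnit (Matrix.of fun i j => B (finBasis ℝ V i) (finBasis ℝ V j)).det := by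
  rw [isUnit_iff_ne_zero]
  intro h0
  obtain ⟨c, hc, hc0⟩ := Matrix.exists_mulVec_eq_zero_iff.2 h0
  have hv : ∑ j, c j • finBasis ℝ V j ≠ 0 := by
    intro h
    exact hc (funext fun j => Fintype.linearIndependent_iff.1 (finBasis ℝ V).linearIndependent c h j)
  refine (pos _ hv).ne' ?_
  have h1 : ∀ i, B (finBasis ℝ V i) (∑ j, c j • finBasis ℝ V j) = 0 := fun i => by
    have := congrFun hc0 i
    simpa [Matrix.mulVec, dotProduct, mul_comm] using this
  rw [LinearMap.map_sum₂]
  exact Finset.sum_eq_zero fun i _ => by rw [LinearMap.map_smul₂, h1, smul_zero]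

/-- Raising an index of the form `g(c, ·)` recovers the coordinates of `c`. -/
lemma sum_inverseGram_mul {g : V → V → ℝ} {B : V →ₗ[ℝ] V →ₗ[ℝ] ℝ} (hB : ∀ u v, g u v = B u v)
    (symm : ∀ u v, B u v = B v u) (pos : ∀ v, v ≠ 0 → 0 < B v v) (c : V)
    (k : Fin (finrank ℝ V)) :
    ∑ l, inverseGram g k l * g c (finBasis ℝ V l) = (finBasis ℝ V).repr c k := by
  have hm : (Matrix.of fun i j => g (finBasis ℝ V i) (finBasis ℝ V j))
      = Matrix.of fun i j => B (finBasis ℝ V i) (finBasis ℝ V j) := by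
    ext i j; simp [hB]
  have hinv := Matrix.nonsing_inv_mul _ (isUnit_det_gram pos)
  have hc : ∀ l, g c (finBasis ℝ V l)
      = ((Matrix.of fun i j => B (finBasis ℝ V i) (finBasis ℝ V j)).mulVec
        ((finBasis ℝ V).repr c)) l := fun l => by
    conv_lhs => rw [hB, ← (finBasis ℝ V).sum_repr c, symm, map_sum]
    simp [Matrix.mulVec, dotProduct, mul_comm]
  simp only [hc]
  have := congrFun (congrArg (fun M => M.mulVec ((finBasis ℝ V).repr c)) hinv) k
  simp only [← Matrix.mulVec_mulVec, Matrix.one_mulVec] at this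
  rw [← this]
  simp [inverseGram, hm, Matrix.mulVec, dotProduct]

/-- The trace of a bilinear form may be computed in any orthonormal basis. -/
lemma metricTrace_eq_sum {ι : Type*} [Fintype ι] [DecidableEq ι] {g h : V → V → ℝ}
    {B C : V →ₗ[ℝ] V →ₗ[ℝ] ℝ} (hB : ∀ u v, g u v = B u v) (hC : ∀ u v, h u v = C u v)
    (symm : ∀ u v, B u v = B v u) (pos : ∀ v, v ≠ 0 → 0 < B v v)
    (e : Basis ι ℝ V) (he : ∀ i j, B (e i) (e j) = if i = j then 1 else 0) :
    metricTrace g h = ∑ a, h (e a) (e a) := by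
  have hrepr : ∀ v a, e.repr v a = B (e a) v := fun v a => by
    conv_rhs => rw [← e.sum_repr v, map_sum]
    simp [he]
  have hexp : ∀ u v, h u v = ∑ a, ∑ b, B (e a) u * (B (e b) v * h (e a) (e b)) := fun u v => by
    conv_lhs => rw [hC, ← e.sum_repr u, ← e.sum_repr v]
    simp only [map_sum, LinearMap.sum_apply, map_smul, LinearMap.smul_apply, smul_eq_mul, hrepr,
      hC, Finset.mul_sum]
    rw [Finset.sum_comm]
    refine Finset.sum_congr rfl fun a _ => Finset.sum_congr rfl fun b _ => by ring
  have hδ : ∀ a b, ∑ i, ∑ j, inverseGram g i j * (B (e a) (finBasis ℝ V i) *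
      B (e b) (finBasis ℝ V j)) = if a = b then 1 else 0 := fun a b => by
    have h1 : ∀ i, ∑ j, inverseGram g i j * (B (e a) (finBasis ℝ V i) *
        B (e b) (finBasis ℝ V j)) = (finBasis ℝ V).repr (e b) i * B (e a) (finBasis ℝ V i) :=
      fun i => by
        rw [← sum_inverseGram_mul hB symm pos, Finset.sum_mul]
        exact Finset.sum_congr rfl fun j _ => by rw [hB]; ring
    simp only [h1]
    rw [← he a b]
    conv_rhs => rw [← (finBasis ℝ V).sum_repr (e b), map_sum]
    simp
  calc metricTrace g h
      = ∑ i, ∑ j, ∑ a, ∑ b, h (e a) (e b) * (inverseGram g i j *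
          (B (e a) (finBasis ℝ V i) * B (e b) (finBasis ℝ V j))) := by
        unfold metricTrace
        refine Finset.sum_congr rfl fun i _ => Finset.sum_congr rfl fun j _ => ?_
        rw [hexp (finBasis ℝ V i), Finset.mul_sum]
        refine Finset.sum_congr rfl fun a _ => ?_
        rw [Finset.mul_sum]
        exact Finset.sum_congr rfl fun b _ => by ring
    _ = ∑ a, ∑ b, h (e a) (e b) * ∑ i, ∑ j, inverseGram g i j *
          (B (e a) (finBasis ℝ V i) * B (e b) (finBasis ℝ V j)) := by
        simp only [Finset.mul_sum]
        have h1 : ∀ (f : Fin (finrank ℝ V) → Fin (finrank ℝ V) → ι → ι → ℝ),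
            ∑ i, ∑ j, ∑ a, ∑ b, f i j a b = ∑ a, ∑ b, ∑ i, ∑ j, f i j a b := fun f => by
          calc ∑ i, ∑ j, ∑ a, ∑ b, f i j a b = ∑ i, ∑ a, ∑ j, ∑ b, f i j a b :=
                Finset.sum_congr rfl fun i _ => Finset.sum_comm
            _ = ∑ a, ∑ i, ∑ j, ∑ b, f i j a b := Finset.sum_comm
            _ = ∑ a, ∑ i, ∑ b, ∑ j, f i j a b :=
                Finset.sum_congr rfl fun a _ => Finset.sum_congr rfl fun i _ => Finset.sum_comm
            _ = ∑ a, ∑ b, ∑ i, ∑ j, f i j a b :=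
                Finset.sum_congr rfl fun a _ => Finset.sum_comm
        exact h1 _
    _ = ∑ a, h (e a) (e a) := by simp [hδ]

end Gram

/-! ### The Levi-Civita connection -/

section Connection

variable {E : Type*} [NormedAddCommGroup E] [NormedSpace ℝ E] [FiniteDimensional ℝ E]

/-- The Koszul formula determines the Christoffel symbols. -/
lemma christoffel_eq_of_koszul {G : E → E →L[ℝ] E →L[ℝ] ℝ} {y : E}
    {G' : E →L[ℝ] E →L[ℝ] E →L[ℝ] ℝ} (hG : HasFDerivAt G G' y)
    (symm : ∀ u v, G y u v = G y v u) (pos : ∀ v, v ≠ 0 → 0 < G y v v) {u v c : E}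
    (h : ∀ w, 2 * G y c w = G' u v w + G' v u w - G' w u v) : christoffel G y u v = c := by
  have key := sum_inverseGram_mul (g := fun a b => G y a b)
    (B := (ContinuousLinearMap.coeLM ℝ).comp (G y).toLinearMap)
    (fun _ _ => rfl) symm pos c
  unfold christoffel
  rw [hG.fderiv]
  conv_rhs => rw [← (finBasis ℝ E).sum_repr c]
  refine Finset.sum_congr rfl fun k _ => ?_
  rw [← Finset.sum_smul, ← key k]
  congr 1
  refine Finset.sum_congr rfl fun l _ => ?_
  rw [← h]
  ring

lemma christoffel_smul_add_smul {p q : E → ℝ} {p' q' : E →L[ℝ] ℝ} {L₁ L₂ : E →L[ℝ] E →L[ℝ] ℝ} {y : E}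
    (hp : HasFDerivAt p p' y) (hq : HasFDerivAt q q' y)
    (symm₁ : ∀ u v, L₁ u v = L₁ v u) (symm₂ : ∀ u v, L₂ u v = L₂ v u)
    (pos : ∀ v, v ≠ 0 → 0 < p y * L₁ v v + q y * L₂ v v) {u v c : E}
    (h : ∀ w, 2 * (p y * L₁ c w + q y * L₂ c w) = p' u * L₁ v w + q' u * L₂ v w
      + (p' v * L₁ u w + q' v * L₂ u w) - (p' w * L₁ u v + q' w * L₂ u v)) :
    christoffel (fun z => p z • L₁ + q z • L₂) y u v = c := by
  refine christoffel_eq_of_koszul ((hp.smul_const L₁).add (hq.smul_const L₂)) ?_ ?_ ?_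
  · intro u v
    simp [symm₁ u, symm₂ u]
  · simpa using pos
  · simpa using h

end Connection

/-! ### Curvature of the model metric in stereographic coordinates -/

section Model

variable {A B : Type*} [NormedAddCommGroup A] [InnerProductSpace ℝ A]
  [NormedAddCommGroup B] [InnerProductSpace ℝ B]

/-- The stereographic factor `4 / (|a|² + 4)`: in stereographic coordinates the round metric is
`stereoFactor a ^ 2` times the Euclidean one. -/
noncomputable def stereoFactor (a : A) : ℝ := 4 / (‖a‖ ^ 2 + 4)

lemma stereoFactor_pos (a : A) : 0 < stereoFactor a := by unfold stereoFactor; positivity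

@[simp] lemma stereoFactor_zero : stereoFactor (0 : A) = 1 := by simp [stereoFactor]

lemma hasFDerivAt_stereoFactor (a : A) :
    HasFDerivAt stereoFactor ((-(stereoFactor a ^ 2 / 2)) • innerSL ℝ a) a := by
  have h1 : HasFDerivAt (fun a : A => ‖a‖ ^ 2 + 4) (2 • innerSL ℝ a) a :=
    (hasStrictFDerivAt_norm_sq a).hasFDerivAt.add_const 4
  have h0 : ‖a‖ ^ 2 + 4 ≠ 0 := by positivity
  have h2 := ((hasDerivAt_inv h0).comp_hasFDerivAt a h1).const_mul 4
  refine (h2.congr_fderiv ?_)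
  ext v
  simp [stereoFactor]
  field_simp
  ring

variable (A B) in
/-- The inner product of the first components on `A × B`. -/
noncomputable def innerFst : (A × B) →L[ℝ] (A × B) →L[ℝ] ℝ :=
  (innerSL ℝ).bilinearComp (ContinuousLinearMap.fst ℝ A B) (ContinuousLinearMap.fst ℝ A B)

variable (A B) in
/-- The inner product of the second components on `A × B`. -/
noncomputable def innerSnd : (A × B) →L[ℝ] (A × B) →L[ℝ] ℝ :=
  (innerSL ℝ).bilinearComp (ContinuousLinearMap.snd ℝ A B) (ContinuousLinearMap.snd ℝ A B)

@[simp] lemma innerFst_apply (u v : A × B) : innerFst A B u v = inner ℝ u.1 v.1 := rfl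

@[simp] lemma innerSnd_apply (u v : A × B) : innerSnd A B u v = inner ℝ u.2 v.2 := rfl

/-- The metric `F (g₁ + g₂)` on `A × B`, where `g₁` and `g₂` are the round metrics of two spheres
in stereographic coordinates. -/
noncomputable def modelMetric (F : A × B → ℝ) (y : A × B) : (A × B) →L[ℝ] (A × B) →L[ℝ] ℝ :=
  (F y * stereoFactor y.1 ^ 2) • innerFst A B + (F y * stereoFactor y.2 ^ 2) • innerSnd A B

lemma modelMetric_apply (F : A × B → ℝ) (y u v : A × B) : modelMetric F y u v =
    F y * (stereoFactor y.1 ^ 2 * inner ℝ u.1 v.1 + stereoFactor y.2 ^ 2 * inner ℝ u.2 v.2) := by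
  simp [modelMetric]
  ring

/-- The Christoffel symbols of `modelMetric F` when `dF = 2 F k ⟨e, ·⟩`, where
`k = stereoFactor y.1`. -/
noncomputable def modelChristoffel (e : A) (y u v : A × B) : A × B :=
  ((stereoFactor y.1 / 2) • ((2 * inner ℝ e u.1 - inner ℝ y.1 u.1) • v.1
      + (2 * inner ℝ e v.1 - inner ℝ y.1 v.1) • u.1
      + (inner ℝ u.1 v.1 : ℝ) • (y.1 - (2 : ℝ) • e))
    - (stereoFactor y.2 ^ 2 * (stereoFactor y.1)⁻¹ * inner ℝ u.2 v.2) • e,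
   (stereoFactor y.1 * inner ℝ e u.1 - stereoFactor y.2 / 2 * inner ℝ y.2 u.2) • v.2
      + (stereoFactor y.1 * inner ℝ e v.1 - stereoFactor y.2 / 2 * inner ℝ y.2 v.2) • u.2
      + (stereoFactor y.2 / 2 * inner ℝ u.2 v.2) • y.2)

lemma christoffel_modelMetric [FiniteDimensional ℝ A] [FiniteDimensional ℝ B]
    {F : A × B → ℝ} {e : A} {y : A × B} (hpos : 0 < F y)
    (hF : HasFDerivAt F ((2 * F y * stereoFactor y.1) •
      (innerSL ℝ e ∘L ContinuousLinearMap.fst ℝ A B)) y) (u v : A × B) :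
    christoffel (modelMetric F) y u v = modelChristoffel e y u v := by
  have h1 := ((hasFDerivAt_stereoFactor y.1).comp y
    (ContinuousLinearMap.fst ℝ A B).hasFDerivAt).pow 2
  have h2 := ((hasFDerivAt_stereoFactor y.2).comp y
    (ContinuousLinearMap.snd ℝ A B).hasFDerivAt).pow 2
  have k1 := stereoFactor_pos y.1
  have k2 := stereoFactor_pos y.2
  refine christoffel_smul_add_smul (hF.mul h1) (hF.mul h2) (L₁ := innerFst A B)
    (L₂ := innerSnd A B) (fun u v => real_inner_comm _ _) (fun u v => real_inner_comm _ _) ?_ ?_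
  · intro v hv
    simp only [innerFst_apply, innerSnd_apply, real_inner_self_eq_norm_sq, Pi.mul_apply,
      Function.comp_apply]
    by_cases h0 : v.1 = 0
    · have : v.2 ≠ 0 := fun h => hv (Prod.ext h0 h)
      have := norm_pos_iff.2 this
      positivity
    · have := norm_pos_iff.2 h0
      positivity
  · intro w
    simp [modelChristoffel, inner_add_left, inner_sub_left, inner_smul_left]
    field_simp
    ring

lemma hasFDerivAt_stereoFactor_zero :
    HasFDerivAt (stereoFactor : A → ℝ) (0 : A →L[ℝ] ℝ) 0 :=
  (hasFDerivAt_stereoFactor 0).congr_fderiv (by simp)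

/-- The factor `stereoFactor` is stationary at the origin, so that only the terms linear in the
coordinates contribute; in particular the derivative does not depend on `e`. -/
lemma fderiv_modelChristoffel (e : A) (u v w : A × B) :
    fderiv ℝ (fun z => modelChristoffel e z v w) 0 u =
      ((1 / 2 : ℝ) • ((inner ℝ v.1 w.1 : ℝ) • u.1 - (inner ℝ u.1 v.1 : ℝ) • w.1
        - (inner ℝ u.1 w.1 : ℝ) • v.1),
       (1 / 2 : ℝ) • ((inner ℝ v.2 w.2 : ℝ) • u.2 - (inner ℝ u.2 v.2 : ℝ) • w.2
        - (inner ℝ u.2 w.2 : ℝ) • v.2)) := by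
  have f1 : HasFDerivAt (fun z : A × B => z.1) (ContinuousLinearMap.fst ℝ A B) 0 :=
    (ContinuousLinearMap.fst ℝ A B).hasFDerivAt
  have f2 : HasFDerivAt (fun z : A × B => z.2) (ContinuousLinearMap.snd ℝ A B) 0 :=
    (ContinuousLinearMap.snd ℝ A B).hasFDerivAt
  have k1 : HasFDerivAt (fun z : A × B => stereoFactor z.1) (0 : A × B →L[ℝ] ℝ) 0 :=
    (HasFDerivAt.comp (g := stereoFactor) (0 : A × B) hasFDerivAt_stereoFactor_zero f1).congr_fderiv
      (ContinuousLinearMap.zero_comp _)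
  have k2 : HasFDerivAt (fun z : A × B => stereoFactor z.2) (0 : A × B →L[ℝ] ℝ) 0 :=
    (HasFDerivAt.comp (g := stereoFactor) (0 : A × B) hasFDerivAt_stereoFactor_zero f2).congr_fderiv
      (ContinuousLinearMap.zero_comp _)
  have i1 : ∀ c : A, HasFDerivAt (fun z : A × B => inner ℝ z.1 c)
      ((innerSL ℝ c) ∘L ContinuousLinearMap.fst ℝ A B) 0 := fun c => by
    simp only [real_inner_comm c]
    exact ((innerSL ℝ c) ∘L ContinuousLinearMap.fst ℝ A B).hasFDerivAt
  have i2 : ∀ c : B, HasFDerivAt (fun z : A × B => inner ℝ z.2 c)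
      ((innerSL ℝ c) ∘L ContinuousLinearMap.snd ℝ A B) 0 := fun c => by
    simp only [real_inner_comm c]
    exact ((innerSL ℝ c) ∘L ContinuousLinearMap.snd ℝ A B).hasFDerivAt
  have k3 : HasFDerivAt (fun z : A × B => stereoFactor z.2 ^ 2 * (stereoFactor z.1)⁻¹)
      (0 : A × B →L[ℝ] ℝ) 0 :=
    ((k2.pow 2).mul ((hasDerivAt_inv (stereoFactor_pos (0 : A × B).1).ne').comp_hasFDerivAt
      (f := fun z : A × B => stereoFactor z.1) 0 k1)).congr_fderiv (by simp)
  have g1 := ((k1.mul_const (2⁻¹ : ℝ)).smul (((((i1 v.1).const_sub (2 * inner ℝ e v.1)).smul_const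
    w.1).add (((i1 w.1).const_sub (2 * inner ℝ e w.1)).smul_const v.1)).add
      ((f1.sub_const ((2 : ℝ) • e)).const_smul (inner ℝ v.1 w.1 : ℝ)))).sub
        ((k3.mul_const (inner ℝ v.2 w.2)).smul_const e)
  have g2 := ((((k1.mul_const (inner ℝ e v.1)).sub ((k2.mul_const (2⁻¹ : ℝ)).mul (i2 v.2))).smul_const
    w.2).add (((k1.mul_const (inner ℝ e w.1)).sub ((k2.mul_const (2⁻¹ : ℝ)).mul (i2 w.2))).smul_const
      v.2)).add (((k2.mul_const (2⁻¹ : ℝ)).mul_const (inner ℝ v.2 w.2)).smul f2)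
  have h1 : HasFDerivAt (fun z : A × B => (modelChristoffel e z v w).1) _ 0 := g1
  have h2 : HasFDerivAt (fun z : A × B => (modelChristoffel e z v w).2) _ 0 := g2
  have h : HasFDerivAt (fun z : A × B => modelChristoffel e z v w) _ 0 := h1.prodMk h2
  have h3 := DFunLike.congr_fun h.fderiv u
  refine h3.trans ?_
  clear h3 h
  ext1
  · simp [real_inner_comm]
    module
  · simp [real_inner_comm]
    module

/-- The curvature at the origin of the product of two round metrics in stereographic coordinates,
and of the conformal rescalings `F` of it with `dF = 2 F k ⟨e, ·⟩`. -/
lemma curvatureEndo_modelMetric [FiniteDimensional ℝ A] [FiniteDimensional ℝ B]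
    {F : A × B → ℝ} {e : A} (hpos : ∀ᶠ y in 𝓝 0, 0 < F y)
    (hF : ∀ᶠ y in 𝓝 0, HasFDerivAt F ((2 * F y * stereoFactor y.1) •
      (innerSL ℝ e ∘L ContinuousLinearMap.fst ℝ A B)) y) (u v w : A × B) :
    curvatureEndo (modelMetric F) 0 u v w =
      ((inner ℝ v.1 w.1 : ℝ) • u.1 - (inner ℝ u.1 w.1 : ℝ) • v.1,
       (inner ℝ v.2 w.2 : ℝ) • u.2 - (inner ℝ u.2 w.2 : ℝ) • v.2)
      + (modelChristoffel e 0 u (modelChristoffel e 0 v w)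
        - modelChristoffel e 0 v (modelChristoffel e 0 u w)) := by
  have h : ∀ u v, (fun z => christoffel (modelMetric F) z u v) =ᶠ[𝓝 0]
      fun z => modelChristoffel e z u v := fun u v => by
    filter_upwards [hpos, hF] with y h1 h2 using christoffel_modelMetric h1 h2 u v
  have h0 : ∀ u v, christoffel (modelMetric F) 0 u v = modelChristoffel e 0 u v :=
    fun u v => (h u v).eq_of_nhds
  simp only [curvatureEndo, (h _ _).fderiv_eq, fderiv_modelChristoffel, h0]
  ext1
  · simp [real_inner_comm]
    module
  · simp [real_inner_comm]
    module

lemma modelChristoffel_zero (e : A) (u v : A × B) : modelChristoffel e 0 u v =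
    ((inner ℝ e u.1 : ℝ) • v.1 + (inner ℝ e v.1 : ℝ) • u.1
      - (inner ℝ u.1 v.1 + inner ℝ u.2 v.2 : ℝ) • e,
     (inner ℝ e u.1 : ℝ) • v.2 + (inner ℝ e v.1 : ℝ) • u.2) := by
  ext1
  · simp [modelChristoffel]
    module
  · simp [modelChristoffel]

/-- In dimension one, the algebraic curvature tensor of constant curvature vanishes. -/
lemma inner_smul_sub_inner_smul_eq_zero {e : A} (hs : ∀ a, (inner ℝ e a : ℝ) • e = a)
    (u v w : A) : (inner ℝ v w : ℝ) • u - (inner ℝ u w : ℝ) • v = 0 := by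
  rw [← hs u, ← hs v]
  simp only [inner_smul_left, smul_smul, ← sub_smul]
  simp
  left; ring

/-- On a cylinder over a sphere only the sphere contributes to the curvature. -/
lemma curvatureEndo_modelMetric_const [FiniteDimensional ℝ A] [FiniteDimensional ℝ B]
    {e : A} (hs : ∀ a, (inner ℝ e a : ℝ) • e = a) (u v w : A × B) :
    curvatureEndo (modelMetric fun _ => 1) 0 u v w =
      (0, (inner ℝ v.2 w.2 : ℝ) • u.2 - (inner ℝ u.2 w.2 : ℝ) • v.2) := by
  rw [curvatureEndo_modelMetric (e := 0) (by simp)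
    (Filter.Eventually.of_forall fun y => by simpa using hasFDerivAt_const (1 : ℝ) y)]
  rw [inner_smul_sub_inner_smul_eq_zero hs]
  simp [modelChristoffel_zero]

/-- The rescaling of a cylinder over a sphere by the square of the exponential of the arc length
is flat. -/
lemma curvatureEndo_modelMetric_exp [FiniteDimensional ℝ A] [FiniteDimensional ℝ B]
    {F : A × B → ℝ} {e : A} (he : ‖e‖ = 1) (hs : ∀ a, (inner ℝ e a : ℝ) • e = a)
    (hpos : ∀ᶠ y in 𝓝 0, 0 < F y)
    (hF : ∀ᶠ y in 𝓝 0, HasFDerivAt F ((2 * F y * stereoFactor y.1) •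
      (innerSL ℝ e ∘L ContinuousLinearMap.fst ℝ A B)) y) (u v w : A × B) :
    curvatureEndo (modelMetric F) 0 u v w = 0 := by
  rw [curvatureEndo_modelMetric hpos hF, inner_smul_sub_inner_smul_eq_zero hs]
  obtain ⟨u1, u2⟩ := u
  obtain ⟨v1, v2⟩ := v
  obtain ⟨w1, w2⟩ := w
  rw [← hs u1, ← hs v1, ← hs w1]
  generalize (inner ℝ e u1 : ℝ) = α
  generalize (inner ℝ e v1 : ℝ) = β
  generalize (inner ℝ e w1 : ℝ) = γ
  ext1
  · simp [modelChristoffel_zero, inner_add_right, inner_sub_right,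
      inner_smul_left, inner_smul_right, he, real_inner_comm]
    module
  · simp [modelChristoffel_zero, inner_add_right, inner_sub_right,
      inner_smul_left, inner_smul_right, he, real_inner_comm]
    module

end Model

/-! ### Stereographic charts of spheres -/

section Charts

variable {n : ℕ}

/-- The parametrization of `S^n ⊂ ℝ^{n+1}` inverse to the preferred chart at `x`, which is the
stereographic projection from `-x`. -/
noncomputable def sphereParam (x : Sph n) :
    EuclideanSpace ℝ (Fin n) → EuclideanSpace ℝ (Fin (n + 1)) :=
  Sph.incl n ∘ (extChartAt (𝓡 n) x).symm

/-- The explicit inverse of the stereographic projection; `U` is an isometry onto the hyperplane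
orthogonal to `x`. -/
lemma exists_sphereParam_eq (x : Sph n) :
    ∃ U : EuclideanSpace ℝ (Fin n) →ₗᵢ[ℝ] EuclideanSpace ℝ (Fin (n + 1)),
      (∀ y, (inner ℝ (U y) (x : EuclideanSpace ℝ (Fin (n + 1))) : ℝ) = 0) ∧
      ∀ y, sphereParam x y = stereoFactor y • U y
        + (2 * stereoFactor y - 1) • (x : EuclideanSpace ℝ (Fin (n + 1))) := by
  have := Fact.mk (@finrank_euclideanSpace_fin ℝ _ (n + 1))
  let V : (ℝ ∙ ((-x : Sph n) : EuclideanSpace ℝ (Fin (n + 1))))ᗮ ≃ₗᵢ[ℝ] EuclideanSpace ℝ (Fin n) :=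
    (OrthonormalBasis.fromOrthogonalSpanSingleton n (ne_zero_of_mem_unit_sphere (-x))).repr
  refine ⟨(Submodule.subtypeₗᵢ _).comp V.symm.toLinearIsometry, fun y => ?_, fun y => ?_⟩
  · have := Submodule.mem_orthogonal_singleton_iff_inner_left.1 (V.symm y).2
    change (inner ℝ ((V.symm y : _) : EuclideanSpace ℝ (Fin (n + 1))) _ : ℝ) = 0
    simpa using this
  · have h : sphereParam x y = ((stereographic' n (-x)).symm y : EuclideanSpace ℝ (Fin (n + 1))) :=
      rfl
    have hn : ‖((V.symm y : _) : EuclideanSpace ℝ (Fin (n + 1)))‖ = ‖y‖ :=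
      V.symm.norm_map y
    rw [h, stereographic'_symm_apply]
    change (‖((V.symm y : _) : EuclideanSpace ℝ (Fin (n + 1)))‖ ^ 2 + 4)⁻¹ • (4 : ℝ) • _ +
      (‖((V.symm y : _) : EuclideanSpace ℝ (Fin (n + 1)))‖ ^ 2 + 4)⁻¹ •
        (‖((V.symm y : _) : EuclideanSpace ℝ (Fin (n + 1)))‖ ^ 2 - 4) • _ = _
    rw [hn, smul_smul, smul_smul]
    have h4 : ‖y‖ ^ 2 + 4 ≠ 0 := by positivity
    have e1 : (‖y‖ ^ 2 + 4)⁻¹ * 4 = stereoFactor y := by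
      unfold stereoFactor; field_simp
    have e2 : (‖y‖ ^ 2 + 4)⁻¹ * (‖y‖ ^ 2 - 4) = -(2 * stereoFactor y - 1) := by
      unfold stereoFactor; field_simp; ring
    rw [e1, e2]
    refine congrArg (stereoFactor y • (V.symm y : EuclideanSpace ℝ (Fin (n + 1))) + ·) ?_
    exact neg_smul_neg _ _

lemma extChartAt_sphere_target (x : Sph n) : (extChartAt (𝓡 n) x).target = univ := by
  have := Fact.mk (@finrank_euclideanSpace_fin ℝ _ (n + 1))
  rw [extChartAt_target]
  have : (chartAt (EuclideanSpace ℝ (Fin n)) x).target = univ := stereographic'_target (-x)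
  simp [this]

lemma extChartAt_sphere_self (x : Sph n) : extChartAt (𝓡 n) x x = 0 := by
  have := Fact.mk (@finrank_euclideanSpace_fin ℝ _ (n + 1))
  change (OrthonormalBasis.fromOrthogonalSpanSingleton (𝕜 := ℝ) n
    (ne_zero_of_mem_unit_sphere (-x))).repr (stereographic (norm_eq_of_mem_sphere (-x)) x) = 0
  have h : stereographic (norm_eq_of_mem_sphere (-x)) x = 0 := stereographic_neg_apply x
  rw [h, map_zero]

lemma sphereParam_zero (x : Sph n) : sphereParam x 0 = x := by
  rw [sphereParam, Function.comp_apply, ← extChartAt_sphere_self x, extChartAt_to_inv]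
  rfl

lemma exists_fderiv_sphereParam_eq (x : Sph n) :
    ∃ U : EuclideanSpace ℝ (Fin n) →ₗᵢ[ℝ] EuclideanSpace ℝ (Fin (n + 1)),
      (∀ y, (inner ℝ (U y) (x : EuclideanSpace ℝ (Fin (n + 1))) : ℝ) = 0) ∧
      (∀ y, sphereParam x y = stereoFactor y • U y
        + (2 * stereoFactor y - 1) • (x : EuclideanSpace ℝ (Fin (n + 1)))) ∧
      ∀ y v, fderiv ℝ (sphereParam x) y v = stereoFactor y • U v
        - (stereoFactor y ^ 2 / 2 * inner ℝ y v) •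
          (U y + (2 : ℝ) • (x : EuclideanSpace ℝ (Fin (n + 1)))) := by
  obtain ⟨U, hU, h⟩ := exists_sphereParam_eq x
  refine ⟨U, hU, h, fun y v => ?_⟩
  have hk := hasFDerivAt_stereoFactor y
  have hU' : HasFDerivAt (fun z => U z) U.toContinuousLinearMap y :=
    U.toContinuousLinearMap.hasFDerivAt
  have h1 := (hk.smul hU').add
    (((hk.const_mul 2).sub_const 1).smul_const (x : EuclideanSpace ℝ (Fin (n + 1))))
  have h2 := h1.congr_of_eventuallyEq (Filter.EventuallyEq.of_eq (funext h))
  rw [h2.fderiv]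
  simp
  module

lemma contDiff_sphereParam (x : Sph n) : ContDiff ℝ ∞ (sphereParam x) := by
  obtain ⟨U, -, h⟩ := exists_sphereParam_eq x
  have hk : ContDiff ℝ ∞ (stereoFactor : EuclideanSpace ℝ (Fin n) → ℝ) := by
    unfold stereoFactor
    exact contDiff_const.div ((contDiff_norm_sq ℝ).add contDiff_const) fun y => by positivity
  rw [funext h]
  exact (hk.smul U.contDiff).add (((contDiff_const.mul hk).sub contDiff_const).smul contDiff_const)

/-- Stereographic projection is conformal. -/
lemma inner_fderiv_sphereParam (x : Sph n) (y v w : EuclideanSpace ℝ (Fin n)) :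
    (inner ℝ (fderiv ℝ (sphereParam x) y v) (fderiv ℝ (sphereParam x) y w) : ℝ) =
      stereoFactor y ^ 2 * inner ℝ v w := by
  obtain ⟨U, hU, -, h⟩ := exists_fderiv_sphereParam_eq x
  have hx : ‖(x : EuclideanSpace ℝ (Fin (n + 1)))‖ = 1 := norm_eq_of_mem_sphere x
  have hU' : ∀ y, (inner ℝ (x : EuclideanSpace ℝ (Fin (n + 1))) (U y) : ℝ) = 0 := fun y => by
    rw [real_inner_comm, hU]
  rw [h, h]
  simp only [inner_add_left, inner_add_right, inner_sub_left, inner_sub_right,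
    real_inner_smul_left, real_inner_smul_right, hU, hU', U.inner_map_map,
    real_inner_self_eq_norm_sq, hx, real_inner_comm v y]
  have h4 : ‖y‖ ^ 2 + 4 ≠ 0 := by positivity
  unfold stereoFactor
  field_simp
  ring

lemma inner_fderiv_sphereParam_zero (x : Sph n) (v : EuclideanSpace ℝ (Fin n)) :
    (inner ℝ (fderiv ℝ (sphereParam x) 0 v) (x : EuclideanSpace ℝ (Fin (n + 1))) : ℝ) = 0 := by
  obtain ⟨U, hU, -, h⟩ := exists_fderiv_sphereParam_eq x
  simp [h, hU]

lemma fderiv_sphereParam_zero_injective (x : Sph n) :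
    Function.Injective (fderiv ℝ (sphereParam x) 0) := by
  obtain ⟨U, -, -, h⟩ := exists_fderiv_sphereParam_eq x
  have : ∀ v, fderiv ℝ (sphereParam x) 0 v = U v := fun v => by simp [h]
  intro v w hvw
  rw [this, this] at hvw
  exact U.injective hvw

end Charts

/-! ### Pullbacks of Euclidean metrics -/

section Pullback

variable {E : Type*} [NormedAddCommGroup E] [NormedSpace ℝ E]
  {H : Type*} [TopologicalSpace H] {I : ModelWithCorners ℝ E H}
  {M : Type*} [TopologicalSpace M] [ChartedSpace H M]
  {F : Type*} [NormedAddCommGroup F] [NormedSpace ℝ F]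
  {K : Type*} [TopologicalSpace K] {J : ModelWithCorners ℝ F K}
  {N : Type*} [TopologicalSpace N] [ChartedSpace K N]
  {V : Type*} [NormedAddCommGroup V] [InnerProductSpace ℝ V]

lemma pullbackTensor_pullbackTensor {E' : Type*} [NormedAddCommGroup E'] [NormedSpace ℝ E']
    {H' : Type*} [TopologicalSpace H'] {I' : ModelWithCorners ℝ E' H'}
    {M' : Type*} [TopologicalSpace M'] [ChartedSpace H' M']
    {f : M → N} {g : N → M'} {x : M} (hf : MDifferentiableAt I J f x)
    (hg : MDifferentiableAt J I' g (f x)) (h : TwoTensorField I' M') :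
    pullbackTensor (I := I) f (pullbackTensor (I := J) g h) x = pullbackTensor (g ∘ f) h x := by
  ext v w
  rw [pullbackTensor_apply, pullbackTensor_apply, pullbackTensor_apply, mfderiv_comp x hg hf]
  rfl

lemma pullbackTensor_fst_apply (g : TwoTensorField I M) (x : M × N)
    (v w : TangentSpace (I.prod J) x) :
    pullbackTensor (I := I.prod J) Prod.fst g x v w = g x.1 (v : E × F).1 (w : E × F).1 := by
  rw [pullbackTensor_apply, mfderiv_fst]
  rfl

lemma pullbackTensor_snd_apply (h : TwoTensorField J N) (x : M × N)
    (v w : TangentSpace (I.prod J) x) :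
    pullbackTensor (I := I.prod J) Prod.snd h x v w = h x.2 (v : E × F).2 (w : E × F).2 := by
  rw [pullbackTensor_apply, mfderiv_snd]
  rfl

lemma pullbackTensor_euclideanTensor (f : E → V) (y v w : E) :
    pullbackTensor (I := 𝓘(ℝ, E)) f (euclideanTensor V) y v w =
      inner ℝ (fderiv ℝ f y v) (fderiv ℝ f y w) :=
  congrArg (fun L : E →L[ℝ] V => (inner ℝ (L v) (L w) : ℝ)) (mfderiv_eq_fderiv (f := f))

lemma pullbackTensor_pullbackTensor_pullbackTensor_euclideanTensor {E' : Type*}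
    [NormedAddCommGroup E'] [NormedSpace ℝ E'] {φ : E' → M} {f : M → N}
    {i : N → V} {y : E'} (hφ : MDifferentiableAt 𝓘(ℝ, E') I φ y)
    (hf : MDifferentiableAt I J f (φ y)) (hi : MDifferentiableAt J 𝓘(ℝ, V) i (f (φ y)))
    (v w : E') :
    pullbackTensor (I := 𝓘(ℝ, E')) φ (pullbackTensor (I := I) f
      (pullbackTensor (I := J) i (euclideanTensor V))) y v w =
      inner ℝ (fderiv ℝ (i ∘ f ∘ φ) y v) (fderiv ℝ (i ∘ f ∘ φ) y w) := by
  refine Eq.trans ?_ (pullbackTensor_euclideanTensor (i ∘ f ∘ φ) y v w)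
  refine Eq.trans ?_ (congrArg (fun L : E' →L[ℝ] E' →L[ℝ] ℝ => L v w)
    (pullbackTensor_pullbackTensor hφ (hi.comp (φ y) hf) (euclideanTensor V)))
  exact congrArg (fun L : E →L[ℝ] E →L[ℝ] ℝ =>
    L (mfderiv 𝓘(ℝ, E') I φ y v) (mfderiv 𝓘(ℝ, E') I φ y w))
    (pullbackTensor_pullbackTensor hf hi (euclideanTensor V))

/-- The differential of a vector-valued map, read in the preferred chart. -/
lemma mfderiv_eq_fderiv_comp_extChartAt_symm [I.Boundaryless] {f : M → F} {x : M}
    (hf : MDifferentiableAt I 𝓘(ℝ, F) f x) :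
    mfderiv I 𝓘(ℝ, F) f x = fderiv ℝ (f ∘ (extChartAt I x).symm) (extChartAt I x x) := by
  refine hf.mfderiv.trans ?_
  change fderivWithin ℝ (f ∘ (extChartAt I x).symm) (range I) (extChartAt I x x) = _
  rw [I.range_eq_univ, fderivWithin_univ]

end Pullback

/-! ### Products of spheres in stereographic coordinates -/

section ProductCharts

variable {m n : ℕ}

lemma contMDiff_extChartAt_symm_prod_sphere (x : Sph m × Sph n) :
    ContMDiff 𝓘(ℝ, EuclideanSpace ℝ (Fin m) × EuclideanSpace ℝ (Fin n)) ((𝓡 m).prod (𝓡 n)) ∞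
      (extChartAt ((𝓡 m).prod (𝓡 n)) x).symm := by
  have h := contMDiffOn_extChartAt_symm (I := (𝓡 m).prod (𝓡 n)) (n := ∞) x
  rwa [extChartAt_prod, PartialEquiv.prod_target, extChartAt_sphere_target,
    extChartAt_sphere_target, univ_prod_univ, contMDiffOn_univ] at h

lemma extChartAt_prod_sphere_self (x : Sph m × Sph n) :
    extChartAt ((𝓡 m).prod (𝓡 n)) x x = 0 :=
  Prod.ext (extChartAt_sphere_self x.1) (extChartAt_sphere_self x.2)

/-- The product of two round metrics in the preferred chart. -/
lemma pullbackTensor_prodMetric_roundMetric (x : Sph m × Sph n)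
    (y v w : EuclideanSpace ℝ (Fin m) × EuclideanSpace ℝ (Fin n)) :
    pullbackTensor (I := 𝓘(ℝ, EuclideanSpace ℝ (Fin m) × EuclideanSpace ℝ (Fin n)))
      (extChartAt ((𝓡 m).prod (𝓡 n)) x).symm (prodMetric (roundMetric m) (roundMetric n)).inner
      y v w = modelMetric (fun _ => 1) y v w := by
  let φ := (extChartAt ((𝓡 m).prod (𝓡 n)) x).symm
  have hφ : MDifferentiable 𝓘(ℝ, EuclideanSpace ℝ (Fin m) × EuclideanSpace ℝ (Fin n))
      ((𝓡 m).prod (𝓡 n)) φ :=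
    (contMDiff_extChartAt_symm_prod_sphere x).mdifferentiable (by simp)
  have hi : ∀ k, MDifferentiable (𝓡 k) 𝓘(ℝ, EuclideanSpace ℝ (Fin (k + 1))) (Sph.incl k) :=
    fun k => (Sph.incl_contMDiff k).mdifferentiable (by simp)
  have e1 : pullbackTensor (I := 𝓘(ℝ, EuclideanSpace ℝ (Fin m) × EuclideanSpace ℝ (Fin n))) φ
      (pullbackTensor (I := (𝓡 m).prod (𝓡 n)) Prod.fst (roundMetric m).inner) y v w =
        inner ℝ (fderiv ℝ (sphereParam x.1) y.1 v.1) (fderiv ℝ (sphereParam x.1) y.1 w.1) := by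
    have hd := ((contDiff_sphereParam x.1).differentiable (by simp)).differentiableAt (x := y.1)
    have hf : fderiv ℝ (Sph.incl m ∘ Prod.fst ∘ φ) y = _ :=
      (hd.hasFDerivAt.comp y (hasFDerivAt_fst (𝕜 := ℝ) (p := y))).fderiv
    have h := pullbackTensor_pullbackTensor_pullbackTensor_euclideanTensor (hφ y)
      mdifferentiableAt_fst (hi m _) v w
    rw [hf] at h
    exact h
  have e2 : pullbackTensor (I := 𝓘(ℝ, EuclideanSpace ℝ (Fin m) × EuclideanSpace ℝ (Fin n))) φ
      (pullbackTensor (I := (𝓡 m).prod (𝓡 n)) Prod.snd (roundMetric n).inner) y v w =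
        inner ℝ (fderiv ℝ (sphereParam x.2) y.2 v.2) (fderiv ℝ (sphereParam x.2) y.2 w.2) := by
    have hd := ((contDiff_sphereParam x.2).differentiable (by simp)).differentiableAt (x := y.2)
    have hf : fderiv ℝ (Sph.incl n ∘ Prod.snd ∘ φ) y = _ :=
      (hd.hasFDerivAt.comp y (hasFDerivAt_snd (𝕜 := ℝ) (p := y))).fderiv
    have h := pullbackTensor_pullbackTensor_pullbackTensor_euclideanTensor (hφ y)
      mdifferentiableAt_snd (hi n _) v w
    rw [hf] at h
    exact h
  rw [modelMetric_apply, one_mul, ← inner_fderiv_sphereParam x.1, ← inner_fderiv_sphereParam x.2]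
  exact congrArg₂ (· + ·) e1 e2

lemma pullbackTensor_smul_prodMetric (f : Sph m × Sph n → ℝ) (x : Sph m × Sph n) :
    pullbackTensor (I := 𝓘(ℝ, EuclideanSpace ℝ (Fin m) × EuclideanSpace ℝ (Fin n)))
      (extChartAt ((𝓡 m).prod (𝓡 n)) x).symm
      (fun z => f z • (prodMetric (roundMetric m) (roundMetric n)).inner z) =
    modelMetric (f ∘ (extChartAt ((𝓡 m).prod (𝓡 n)) x).symm) := by
  funext y
  refine ContinuousLinearMap.ext fun v => ContinuousLinearMap.ext fun w => ?_
  exact (congrArg (f ((extChartAt ((𝓡 m).prod (𝓡 n)) x).symm y) * ·)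
    ((pullbackTensor_prodMetric_roundMetric x y v w).trans
      ((modelMetric_apply _ y v w).trans (one_mul _)))).trans
    (modelMetric_apply (f ∘ (extChartAt ((𝓡 m).prod (𝓡 n)) x).symm) y v w).symm

lemma roundMetric_inner (x : Sph n) (u v : EuclideanSpace ℝ (Fin n)) :
    (roundMetric n).inner x u v = (inner ℝ u v : ℝ) := by
  have h := mfderiv_eq_fderiv_comp_extChartAt_symm
    ((Sph.incl_contMDiff n).mdifferentiable (by simp) x)
  rw [extChartAt_sphere_self] at h
  refine (congrArg (fun L : EuclideanSpace ℝ (Fin n) →L[ℝ] EuclideanSpace ℝ (Fin (n + 1)) =>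
    (inner ℝ (L u) (L v) : ℝ)) h).trans ?_
  refine (inner_fderiv_sphereParam x 0 u v).trans ?_
  rw [stereoFactor_zero, one_pow, one_mul]

end ProductCharts

/-! ### Curvature of `S¹ × S³` -/

section Curvature

lemma dxSquared_apply (x : Sph 1 × Sph 3)
    (u v : EuclideanSpace ℝ (Fin 1) × EuclideanSpace ℝ (Fin 3)) :
    dxSquared x u v = (inner ℝ u.1 v.1 : ℝ) :=
  (pullbackTensor_fst_apply _ x u v).trans (roundMetric_inner x.1 u.1 v.1)

lemma tensorS3_apply (x : Sph 1 × Sph 3)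
    (u v : EuclideanSpace ℝ (Fin 1) × EuclideanSpace ℝ (Fin 3)) :
    tensorS3 x u v = (inner ℝ u.2 v.2 : ℝ) :=
  (pullbackTensor_snd_apply _ x u v).trans (roundMetric_inner x.2 u.2 v.2)

lemma metricS1S3_apply (x : Sph 1 × Sph 3)
    (u v : EuclideanSpace ℝ (Fin 1) × EuclideanSpace ℝ (Fin 3)) :
    metricS1S3.inner x u v = (inner ℝ u.1 v.1 + inner ℝ u.2 v.2 : ℝ) :=
  congrArg₂ (· + ·) (dxSquared_apply x u v) (tensorS3_apply x u v)

lemma inner_smul_eq_self_of_norm_eq_one {e : EuclideanSpace ℝ (Fin 1)} (he : ‖e‖ = 1)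
    (a : EuclideanSpace ℝ (Fin 1)) : (inner ℝ e a : ℝ) • e = a := by
  have h : e 0 * e 0 = 1 := by
    rw [← pow_two, ← Real.sqrt_eq_one, ← he, EuclideanSpace.norm_eq]
    simp
  ext i
  fin_cases i
  simp [PiLp.inner_apply]
  linear_combination a 0 * h

/-- Only the three-dimensional factor contributes to the curvature. The coordinates of the tangent
vectors are those of the preferred chart at `x`, in which `metricS1S3` is standard at `x`. -/
lemma riemannTensor_metricS1S3 (x : Sph 1 × Sph 3)
    (X Y Z T : EuclideanSpace ℝ (Fin 1) × EuclideanSpace ℝ (Fin 3)) :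
    riemannTensor metricS1S3.inner x X Y Z T =
      (inner ℝ X.2 Z.2 * inner ℝ Y.2 T.2 - inner ℝ X.2 T.2 * inner ℝ Y.2 Z.2 : ℝ) := by
  have h : pullbackTensor (I := 𝓘(ℝ, EuclideanSpace ℝ (Fin 1) × EuclideanSpace ℝ (Fin 3)))
      (extChartAt ((𝓡 1).prod (𝓡 3)) x).symm metricS1S3.inner = modelMetric fun _ => 1 :=
    funext fun y => ContinuousLinearMap.ext fun v => ContinuousLinearMap.ext fun w =>
      pullbackTensor_prodMetric_roundMetric x y v w
  unfold riemannTensor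
  rw [h, extChartAt_prod_sphere_self]
  refine (congrArg (fun u : EuclideanSpace ℝ (Fin 1) × EuclideanSpace ℝ (Fin 3) =>
    metricS1S3.inner x u Z)
      (curvatureEndo_modelMetric_const (inner_smul_eq_self_of_norm_eq_one
        (e := EuclideanSpace.single 0 1) (by simp)) X Y T)).trans ?_
  refine (metricS1S3_apply x _ Z).trans ?_
  simp only [inner_zero_left, inner_sub_left, real_inner_smul_left]
  ring

lemma metricTrace_innerFst_add_innerSnd
    {h : EuclideanSpace ℝ (Fin 1) × EuclideanSpace ℝ (Fin 3) →
      EuclideanSpace ℝ (Fin 1) × EuclideanSpace ℝ (Fin 3) → ℝ}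
    {C : (EuclideanSpace ℝ (Fin 1) × EuclideanSpace ℝ (Fin 3)) →ₗ[ℝ]
      (EuclideanSpace ℝ (Fin 1) × EuclideanSpace ℝ (Fin 3)) →ₗ[ℝ] ℝ}
    (hC : ∀ u v, h u v = C u v) :
    metricTrace (fun u v : EuclideanSpace ℝ (Fin 1) × EuclideanSpace ℝ (Fin 3) =>
      (inner ℝ u.1 v.1 + inner ℝ u.2 v.2 : ℝ)) h =
      h (EuclideanSpace.single 0 1, 0) (EuclideanSpace.single 0 1, 0) +
      ∑ i : Fin 3, h (0, EuclideanSpace.single i 1) (0, EuclideanSpace.single i 1) := by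
  let B : (EuclideanSpace ℝ (Fin 1) × EuclideanSpace ℝ (Fin 3)) →ₗ[ℝ]
      (EuclideanSpace ℝ (Fin 1) × EuclideanSpace ℝ (Fin 3)) →ₗ[ℝ] ℝ :=
    (innerₗ _).compl₁₂ (LinearMap.fst ℝ _ _) (LinearMap.fst ℝ _ _) +
      (innerₗ _).compl₁₂ (LinearMap.snd ℝ _ _) (LinearMap.snd ℝ _ _)
  have hB : ∀ u v, B u v = (inner ℝ u.1 v.1 + inner ℝ u.2 v.2 : ℝ) := fun _ _ => rfl
  let e := (EuclideanSpace.basisFun (Fin 1) ℝ).toBasis.prod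
    (EuclideanSpace.basisFun (Fin 3) ℝ).toBasis
  rw [metricTrace_eq_sum (B := B) (C := C) (fun u v => (hB u v).symm) hC
    (fun u v => by simp only [hB, real_inner_comm]) ?_ e ?_]
  · simp [e]
  · intro v hv
    rw [hB]
    simp only [real_inner_self_eq_norm_sq]
    by_cases h0 : v.1 = 0
    · have : v.2 ≠ 0 := fun h => hv (Prod.ext h0 h)
      have := norm_pos_iff.2 this
      positivity
    · have := norm_pos_iff.2 h0
      positivity
  · rintro (i | i) (j | j)
    · obtain rfl := Subsingleton.elim i j
      simp [e, hB]
    all_goals simp [e, hB, PiLp.inner_apply, eq_comm]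

/-- The Weyl part of the curvature tensor of the cylinder over a round 3-sphere vanishes:
`Ric = 2 g₂` and `s = 6`, where `g = g₁ + g₂`. -/
lemma weylPart_cylinder (X Y Z T : EuclideanSpace ℝ (Fin 1) × EuclideanSpace ℝ (Fin 3)) :
    weylPart (fun u v : EuclideanSpace ℝ (Fin 1) × EuclideanSpace ℝ (Fin 3) =>
      (inner ℝ u.1 v.1 + inner ℝ u.2 v.2 : ℝ))
      (fun X Y Z T => (inner ℝ X.2 Z.2 * inner ℝ Y.2 T.2 - inner ℝ X.2 T.2 * inner ℝ Y.2 Z.2 : ℝ))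
      X Y Z T = 0 := by
  have hric : ∀ X Y, ricciContraction
      (fun u v : EuclideanSpace ℝ (Fin 1) × EuclideanSpace ℝ (Fin 3) =>
        (inner ℝ u.1 v.1 + inner ℝ u.2 v.2 : ℝ))
      (fun X Y Z T => (inner ℝ X.2 Z.2 * inner ℝ Y.2 T.2 - inner ℝ X.2 T.2 * inner ℝ Y.2 Z.2 : ℝ))
      X Y = (2 * inner ℝ X.2 Y.2 : ℝ) := fun X Y => by
    refine (metricTrace_innerFst_add_innerSnd (C := LinearMap.mk₂ ℝ
      (fun u v => (inner ℝ u.2 v.2 * inner ℝ X.2 Y.2 - inner ℝ u.2 Y.2 * inner ℝ X.2 v.2 : ℝ))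
      (fun _ _ _ => by simp [inner_add_left]; ring)
      (fun _ _ _ => by simp [real_inner_smul_left]; ring)
      (fun _ _ _ => by simp [inner_add_right]; ring)
      (fun _ _ _ => by simp [real_inner_smul_right]; ring)) (fun u v => rfl)).trans ?_
    simp [Fin.sum_univ_three, PiLp.inner_apply]
    ring
  have hs : scalarContraction
      (fun u v : EuclideanSpace ℝ (Fin 1) × EuclideanSpace ℝ (Fin 3) =>
        (inner ℝ u.1 v.1 + inner ℝ u.2 v.2 : ℝ))
      (fun X Y Z T => (inner ℝ X.2 Z.2 * inner ℝ Y.2 T.2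
        - inner ℝ X.2 T.2 * inner ℝ Y.2 Z.2 : ℝ)) = 6 := by
    unfold scalarContraction
    rw [metricTrace_innerFst_add_innerSnd (C := LinearMap.mk₂ ℝ
      (fun u v => (2 * inner ℝ u.2 v.2 : ℝ))
      (fun _ _ _ => by simp [inner_add_left]; ring)
      (fun _ _ _ => by simp [real_inner_smul_left]; ring)
      (fun _ _ _ => by simp [inner_add_right]; ring)
      (fun _ _ _ => by simp [real_inner_smul_right]; ring)) (fun u v => hric u v)]
    simp [hric]
    norm_num
  have hd : (finrank ℝ (EuclideanSpace ℝ (Fin 1) × EuclideanSpace ℝ (Fin 3)) : ℝ) = 4 := by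
    simp
  simp only [weylPart, traceFreeRicci, hric, hs, hd, kulkarniNomizu, Matrix.det_fin_two_of]
  simp only [PiLp.inner_apply, Fin.sum_univ_three, Fin.sum_univ_one, RCLike.inner_apply, conj_trivial]
  ring

lemma kulkarniNomizu_cylinder (X Y Z T : EuclideanSpace ℝ (Fin 1) × EuclideanSpace ℝ (Fin 3)) :
    kulkarniNomizu (fun u v : EuclideanSpace ℝ (Fin 1) × EuclideanSpace ℝ (Fin 3) =>
      (inner ℝ u.1 v.1 + inner ℝ u.2 v.2 : ℝ))
      (fun u v => ((inner ℝ u.2 v.2 - inner ℝ u.1 v.1) / 2 : ℝ)) X Y Z T =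
      (inner ℝ X.2 Z.2 * inner ℝ Y.2 T.2 - inner ℝ X.2 T.2 * inner ℝ Y.2 Z.2 : ℝ) := by
  simp only [kulkarniNomizu, Matrix.det_fin_two_of, PiLp.inner_apply, Fin.sum_univ_three,
    Fin.sum_univ_one, RCLike.inner_apply, conj_trivial]
  ring

lemma weylTensor_metricS1S3 (x : Sph 1 × Sph 3)
    (X Y Z T : TangentSpace ((𝓡 1).prod (𝓡 3)) x) :
    weylTensor metricS1S3.inner x X Y Z T = 0 := by
  have hg : (fun u v : TangentSpace ((𝓡 1).prod (𝓡 3)) x => metricS1S3.inner x u v) =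
    fun u v : EuclideanSpace ℝ (Fin 1) × EuclideanSpace ℝ (Fin 3) =>
      (inner ℝ u.1 v.1 + inner ℝ u.2 v.2 : ℝ) :=
    funext fun u => funext fun v => metricS1S3_apply x u v
  have hR : riemannTensor metricS1S3.inner x =
    fun X Y Z T : EuclideanSpace ℝ (Fin 1) × EuclideanSpace ℝ (Fin 3) =>
      (inner ℝ X.2 Z.2 * inner ℝ Y.2 T.2 - inner ℝ X.2 T.2 * inner ℝ Y.2 Z.2 : ℝ) :=
    funext fun X => funext fun Y => funext fun Z => funext fun T =>
      riemannTensor_metricS1S3 x X Y Z T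
  unfold weylTensor
  rw [hg, hR]
  exact weylPart_cylinder X Y Z T

lemma riemannTensor_metricS1S3_eq_kulkarniNomizu (x : Sph 1 × Sph 3)
    (X Y Z T : TangentSpace ((𝓡 1).prod (𝓡 3)) x) :
    riemannTensor metricS1S3.inner x X Y Z T =
      kulkarniNomizu (fun u v => metricS1S3.inner x u v)
        (fun u v => (tensorS3 x u v - dxSquared x u v) / 2) X Y Z T := by
  have hg : (fun u v : TangentSpace ((𝓡 1).prod (𝓡 3)) x => metricS1S3.inner x u v) =
    fun u v : EuclideanSpace ℝ (Fin 1) × EuclideanSpace ℝ (Fin 3) =>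
      (inner ℝ u.1 v.1 + inner ℝ u.2 v.2 : ℝ) :=
    funext fun u => funext fun v => metricS1S3_apply x u v
  have hh : (fun u v : TangentSpace ((𝓡 1).prod (𝓡 3)) x =>
      (tensorS3 x u v - dxSquared x u v) / 2) =
    fun u v : EuclideanSpace ℝ (Fin 1) × EuclideanSpace ℝ (Fin 3) =>
      ((inner ℝ u.2 v.2 - inner ℝ u.1 v.1) / 2 : ℝ) :=
    funext fun u => funext fun v =>
      congrArg (· / (2 : ℝ)) (congrArg₂ (· - ·) (tensorS3_apply x u v) (dxSquared_apply x u v))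
  rw [hg, hh]
  exact (riemannTensor_metricS1S3 x X Y Z T).trans (kulkarniNomizu_cylinder X Y Z T).symm

lemma isSelfDual_of_weylTensor_eq_zero {E : Type*} [NormedAddCommGroup E] [NormedSpace ℝ E]
    [FiniteDimensional ℝ E] [Fact (finrank ℝ E = 4)]
    {H : Type*} [TopologicalSpace H] {I : ModelWithCorners ℝ E H} [I.Boundaryless]
    {M : Type*} [TopologicalSpace M] [ChartedSpace H M] [IsManifold I ∞ M]
    {g : SmoothMetric I M} (h : ∀ x X Y Z T, weylTensor g.inner x X Y Z T = 0)
    (o : ∀ x : M, Orientation ℝ (TangentSpace I x) (Fin 4)) : IsSelfDual g o := by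
  intro x α _ β _
  simp [formInner, curvatureOperator, h]

end Curvature

/-! ### Local conformal flatness -/

section ConformallyFlat

/-- The identification of `ℝ²` with `ℂ`. -/
noncomputable def planeToComplex : EuclideanSpace ℝ (Fin (1 + 1)) ≃ₗᵢ[ℝ] ℂ :=
  Complex.orthonormalBasisOneI.repr.symm

lemma eq_or_eq_neg_I_mul_of_inner_eq_zero {z w : ℂ} (hz : ‖z‖ = 1) (hw : ‖w‖ = 1)
    (h : (inner ℝ z w : ℝ) = 0) : z = Complex.I * w ∨ z = -(Complex.I * w) := by
  have hw1 : w * (starRingEnd ℂ) w = 1 := by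
    rw [Complex.mul_conj, Complex.normSq_eq_norm_sq, hw]; norm_num
  have hre : (z * (starRingEnd ℂ) w).re = 0 := by
    rw [← h, Complex.inner]
    simp
    ring
  have hn : ‖z * (starRingEnd ℂ) w‖ = 1 := by simp [hz, hw]
  have him : (z * (starRingEnd ℂ) w).im ^ 2 = 1 := by
    have := Complex.normSq_eq_norm_sq (z * (starRingEnd ℂ) w)
    rw [Complex.normSq_apply, hre, hn] at this
    linarith
  have key : z = z * (starRingEnd ℂ) w * w := by
    rw [mul_assoc, mul_comm _ w, hw1, mul_one]
  rcases sq_eq_sq_iff_eq_or_eq_neg.1 (him.trans (one_pow 2).symm) with h1 | h1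
  · left
    rw [key, Complex.ext (z := z * (starRingEnd ℂ) w) (w := Complex.I) (by simpa using hre)
      (by simpa using h1)]
  · right
    rw [key, Complex.ext (z := z * (starRingEnd ℂ) w) (w := -Complex.I) (by simpa using hre)
      (by simpa using h1), neg_mul]

/-- In the stereographic chart the circle is parametrized with speed `stereoFactor`. -/
lemma exists_planeToComplex_fderiv_sphereParam (x : Sph 1) :
    ∃ e : EuclideanSpace ℝ (Fin 1), ‖e‖ = 1 ∧ ∀ a v,
      planeToComplex (fderiv ℝ (sphereParam x) a v) =
        ((stereoFactor a * inner ℝ e v : ℝ) : ℂ) * Complex.I *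
          planeToComplex (sphereParam x a) := by
  obtain ⟨U, hU, hx, hd⟩ := exists_fderiv_sphereParam_eq x
  obtain ⟨e, he, hUe⟩ : ∃ e : EuclideanSpace ℝ (Fin 1), ‖e‖ = 1 ∧
      planeToComplex (U e) = Complex.I * planeToComplex x := by
    have h1 : ‖planeToComplex (U (EuclideanSpace.single 0 1))‖ = 1 := by simp
    have h2 : ‖planeToComplex x‖ = 1 := by
      rw [planeToComplex.norm_map]; exact norm_eq_of_mem_sphere x
    have h3 : (inner ℝ (planeToComplex (U (EuclideanSpace.single 0 1))) (planeToComplex x) : ℝ)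
        = 0 := by
      rw [planeToComplex.inner_map_map, hU]
    rcases eq_or_eq_neg_I_mul_of_inner_eq_zero h1 h2 h3 with h | h
    · exact ⟨EuclideanSpace.single 0 1, by simp, h⟩
    · exact ⟨-EuclideanSpace.single 0 1, by simp, by simp only [map_neg, h, neg_neg]⟩
  refine ⟨e, he, fun a v => ?_⟩
  have hs := inner_smul_eq_self_of_norm_eq_one he
  have hU' : ∀ b, planeToComplex (U b) = (inner ℝ e b : ℝ) * (Complex.I * planeToComplex x) :=
    fun b => by
      conv_lhs => rw [← hs b, map_smul, map_smul, hUe, Complex.real_smul]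
  have hav : (inner ℝ a v : ℝ) = inner ℝ e a * inner ℝ e v := by
    conv_lhs => rw [← hs a, real_inner_smul_left]
  have hk : ((stereoFactor a : ℝ) : ℂ) * (((inner ℝ e a : ℝ) : ℂ) ^ 2 + 4) = 4 := by
    have h1 : ‖a‖ ^ 2 = (inner ℝ e a : ℝ) ^ 2 := by
      conv_lhs => rw [← hs a, norm_smul, he, mul_one, Real.norm_eq_abs, sq_abs]
    have h2 : stereoFactor a * ((inner ℝ e a : ℝ) ^ 2 + 4) = 4 := by
      rw [← h1, stereoFactor, div_mul_cancel₀]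
      positivity
    exact_mod_cast h2
  rw [hd, hx, hav]
  simp only [map_add, map_sub, map_smul, hU', Complex.real_smul]
  push_cast
  linear_combination (-(((stereoFactor a : ℝ) : ℂ) * ((inner ℝ e v : ℝ) : ℂ) * planeToComplex x *
      Complex.I / 2)) * hk - ((stereoFactor a : ℝ) : ℂ) ^ 2 * ((inner ℝ e v : ℝ) : ℂ) *
      ((inner ℝ e a : ℝ) : ℂ) * planeToComplex x * Complex.I_sq

/-- The square of the exponential of the arc length measured from `p`, as a function on the plane:
`exp (2 arg (z / p))`. -/
noncomputable def expTwoAngle (p z : EuclideanSpace ℝ (Fin (1 + 1))) : ℝ :=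
  Real.exp (2 * (Complex.log (planeToComplex z / planeToComplex p)).im)

/-- The plane minus the closed ray through `-p`, where `expTwoAngle p` is smooth. -/
def angleDomain (p : EuclideanSpace ℝ (Fin (1 + 1))) : Set (EuclideanSpace ℝ (Fin (1 + 1))) :=
  {z | planeToComplex z / planeToComplex p ∈ Complex.slitPlane}

lemma continuous_planeToComplex_div (p : EuclideanSpace ℝ (Fin (1 + 1))) :
    Continuous fun z => planeToComplex z / planeToComplex p :=
  planeToComplex.continuous.div_const _

lemma isOpen_angleDomain (p : EuclideanSpace ℝ (Fin (1 + 1))) : IsOpen (angleDomain p) :=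
  Complex.isOpen_slitPlane.preimage (continuous_planeToComplex_div p)

lemma hasFDerivAt_planeToComplex_div (p z : EuclideanSpace ℝ (Fin (1 + 1))) :
    HasFDerivAt (fun z => planeToComplex z / planeToComplex p)
      ((planeToComplex p)⁻¹ • (planeToComplex : EuclideanSpace ℝ (Fin (1 + 1)) →L[ℝ] ℂ)) z := by
  have h : HasFDerivAt (fun z => planeToComplex z)
      (planeToComplex : EuclideanSpace ℝ (Fin (1 + 1)) →L[ℝ] ℂ) z :=
    (planeToComplex : EuclideanSpace ℝ (Fin (1 + 1)) →L[ℝ] ℂ).hasFDerivAt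
  simpa only [div_eq_inv_mul] using h.const_mul (planeToComplex p)⁻¹

lemma contDiffAt_expTwoAngle {p z : EuclideanSpace ℝ (Fin (1 + 1))} (hz : z ∈ angleDomain p) :
    ContDiffAt ℝ ∞ (expTwoAngle p) z := by
  have h1 : ContDiffAt ℝ ∞ Complex.log (planeToComplex z / planeToComplex p) :=
    (Complex.contDiffAt_log hz).restrict_scalars ℝ
  have h2 : ContDiff ℝ ∞ fun z => planeToComplex z / planeToComplex p := by
    simp only [div_eq_inv_mul]
    exact contDiff_const.mul planeToComplex.contDiff
  have h3 := Complex.imCLM.contDiff.contDiffAt.comp z (h1.comp z h2.contDiffAt)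
  exact Real.contDiff_exp.contDiffAt.comp z (contDiffAt_const.mul h3)

lemma hasFDerivAt_expTwoAngle {p z : EuclideanSpace ℝ (Fin (1 + 1))} (hz : z ∈ angleDomain p) :
    ∃ L : EuclideanSpace ℝ (Fin (1 + 1)) →L[ℝ] ℝ, HasFDerivAt (expTwoAngle p) L z ∧
      ∀ v, L v = 2 * expTwoAngle p z * (planeToComplex v / planeToComplex z).im := by
  have h1 := (Complex.hasStrictDerivAt_log hz).hasDerivAt.hasFDerivAt.restrictScalars ℝ
  have h2 := h1.comp z (hasFDerivAt_planeToComplex_div p z)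
  have h3 := (Complex.imCLM.hasFDerivAt.comp z h2).const_mul 2
  have h4 := (Real.hasDerivAt_exp _).comp_hasFDerivAt z h3
  refine ⟨_, h4, fun v => ?_⟩
  have hp : planeToComplex p ≠ 0 := by
    intro h
    have := Complex.slitPlane_ne_zero hz
    simp [h] at this
  have e : (planeToComplex v / planeToComplex z) =
      (planeToComplex p)⁻¹ * planeToComplex v * (planeToComplex z / planeToComplex p)⁻¹ := by
    have hz0 : planeToComplex z ≠ 0 := by
      intro h
      have := Complex.slitPlane_ne_zero hz
      simp [h] at this
    field_simp
  rw [e]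
  simp [expTwoAngle]
  ring

/-- The function `expTwoAngle` satisfies the differential equation of
`curvatureEndo_modelMetric_exp`. -/
lemma hasFDerivAt_expTwoAngle_comp_sphereParam (x : Sph 1) :
    ∃ e : EuclideanSpace ℝ (Fin 1), ‖e‖ = 1 ∧
      ∀ (p : EuclideanSpace ℝ (Fin (1 + 1))) (y : EuclideanSpace ℝ (Fin 1)),
      sphereParam x y ∈ angleDomain p → HasFDerivAt (expTwoAngle p ∘ sphereParam x)
        ((2 * expTwoAngle p (sphereParam x y) * stereoFactor y) • innerSL ℝ e) y := by
  obtain ⟨e, he, h⟩ := exists_planeToComplex_fderiv_sphereParam x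
  refine ⟨e, he, fun p y hy => ?_⟩
  obtain ⟨L, hL, hL'⟩ := hasFDerivAt_expTwoAngle hy
  have hz : planeToComplex (sphereParam x y) ≠ 0 := by
    intro h
    have := Complex.slitPlane_ne_zero hy
    simp [h] at this
  have hd := ((contDiff_sphereParam x).differentiable (by simp) y).hasFDerivAt
  refine (hL.comp y hd).congr_fderiv ?_
  ext v
  rw [ContinuousLinearMap.comp_apply, hL', h, mul_div_assoc, div_self hz, mul_one]
  simp
  ring

/-- The conformal factor: the metric `e^{2t} (dt² + g_{S³})` is the flat metric in polar
coordinates on `ℝ⁴ ∖ 0`. -/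
lemma isLocallyConformallyFlat_metricS1S3 : IsLocallyConformallyFlat metricS1S3 := by
  intro p
  have hi : ContMDiff ((𝓡 1).prod (𝓡 3)) 𝓘(ℝ, EuclideanSpace ℝ (Fin (1 + 1))) ∞
      fun x : Sph 1 × Sph 3 => Sph.incl 1 x.1 := (Sph.incl_contMDiff 1).comp contMDiff_fst
  refine ⟨{x | Sph.incl 1 x.1 ∈ angleDomain (Sph.incl 1 p.1)},
    (isOpen_angleDomain _).preimage hi.continuous, ?_,
    fun x => expTwoAngle (Sph.incl 1 p.1) (Sph.incl 1 x.1), ?_, fun x _ => Real.exp_pos _, ?_⟩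
  · have h0 : planeToComplex (Sph.incl 1 p.1) ≠ 0 := by
      rw [Ne, planeToComplex.map_eq_zero_iff]
      exact ne_zero_of_mem_unit_sphere p.1
    change _ / _ ∈ Complex.slitPlane
    rw [div_self h0]
    exact Complex.one_mem_slitPlane
  · intro x hx
    exact ((contDiffAt_expTwoAngle hx).contMDiffAt.comp x hi.contMDiffAt).contMDiffWithinAt
  · intro x hx u v _
    obtain ⟨e, he, hF⟩ := hasFDerivAt_expTwoAngle_comp_sphereParam x.1
    have hcurv : ∀ u v w : EuclideanSpace ℝ (Fin 1) × EuclideanSpace ℝ (Fin 3),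
        curvatureEndo (modelMetric ((fun x : Sph 1 × Sph 3 =>
          expTwoAngle (Sph.incl 1 p.1) (Sph.incl 1 x.1)) ∘
          (extChartAt ((𝓡 1).prod (𝓡 3)) x).symm)) 0 u v w = 0 := by
      refine curvatureEndo_modelMetric_exp he (inner_smul_eq_self_of_norm_eq_one he)
        (Filter.Eventually.of_forall fun _ => Real.exp_pos _) ?_
      have hcont : Continuous fun y : EuclideanSpace ℝ (Fin 1) × EuclideanSpace ℝ (Fin 3) =>
          sphereParam x.1 y.1 := (contDiff_sphereParam x.1).continuous.comp continuous_fst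
      have h0 : sphereParam x.1 (0 : EuclideanSpace ℝ (Fin 1) × EuclideanSpace ℝ (Fin 3)).1 ∈
          angleDomain (Sph.incl 1 p.1) := by
        rw [Prod.fst_zero, sphereParam_zero]
        exact hx
      filter_upwards [hcont.continuousAt.preimage_mem_nhds
        ((isOpen_angleDomain _).mem_nhds h0)] with y hy
      exact (hF _ y.1 hy).comp y hasFDerivAt_fst
    have hR : riemannTensor (fun y => expTwoAngle (Sph.incl 1 p.1) (Sph.incl 1 y.1) •
        metricS1S3.inner y) x u v u v = 0 := by
      unfold riemannTensor
      rw [extChartAt_prod_sphere_self]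
      have h1 := pullbackTensor_smul_prodMetric (fun x : Sph 1 × Sph 3 =>
          expTwoAngle (Sph.incl 1 p.1) (Sph.incl 1 x.1)) x
      have h2 := (congrArg (fun G => curvatureEndo
        (E := EuclideanSpace ℝ (Fin 1) × EuclideanSpace ℝ (Fin 3)) G 0 u v v) h1).trans (hcurv u v v)
      refine (congrArg (fun c : EuclideanSpace ℝ (Fin 1) × EuclideanSpace ℝ (Fin 3) =>
        (expTwoAngle (Sph.incl 1 p.1) (Sph.incl 1 x.1) • metricS1S3.inner x) c u) h2).trans ?_
      exact congrArg (fun L : (EuclideanSpace ℝ (Fin 1) × EuclideanSpace ℝ (Fin 3)) →L[ℝ] ℝ => L u)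
        (map_zero _)
    unfold sectionalCurvature
    rw [hR, zero_div]

end ConformallyFlat

/-! ### Orientability -/

section OrientationForms

variable {V : Type*} [AddCommGroup V] [Module ℝ V] [FiniteDimensional ℝ V]

lemma AlternatingMap.linearIndependent_of_apply_ne_zero {k : ℕ} {θ : V [⋀^Fin k]→ₗ[ℝ] ℝ}
    {v : Fin k → V} (h : θ v ≠ 0) : LinearIndependent ℝ v := by
  by_contra hv
  exact h (θ.map_linearDependent v hv)

/-- The positive frames of the orientation defined by a volume form. -/
lemma isPositiveFrame_rayOfNeZero_iff (hV : finrank ℝ V = 4) {θ : V [⋀^Fin 4]→ₗ[ℝ] ℝ}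
    (hθ : θ ≠ 0) (v : Fin 4 → V) : IsPositiveFrame (rayOfNeZero ℝ θ hθ) v ↔ 0 < θ v := by
  constructor
  · rintro ⟨b, rfl, hb⟩
    rw [Basis.orientation, ray_eq_iff] at hb
    obtain ⟨r, s, hr, hs, h⟩ := hb.exists_pos b.det_ne_zero hθ
    have h1 := DFunLike.congr_fun h (⇑b)
    simp only [AlternatingMap.smul_apply, Basis.det_self, smul_eq_mul, mul_one] at h1
    exact (pos_iff_pos_of_mul_pos (h1 ▸ hr)).1 hs
  · intro h
    have hli := AlternatingMap.linearIndependent_of_apply_ne_zero h.ne'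
    let b := basisOfLinearIndependentOfCardEqFinrank hli (by simp [hV])
    have hb : ⇑b = v := coe_basisOfLinearIndependentOfCardEqFinrank hli _
    refine ⟨b, hb, ?_⟩
    rw [Basis.orientation, ray_eq_iff, θ.eq_smul_basis_det b, hb]
    exact SameRay.sameRay_pos_smul_right _ h

end OrientationForms

section Orientability

variable {E : Type*} [NormedAddCommGroup E] [NormedSpace ℝ E] [FiniteDimensional ℝ E]
  {H : Type*} [TopologicalSpace H] {I : ModelWithCorners ℝ E H}
  {M : Type*} [TopologicalSpace M] [ChartedSpace H M]

/-- Volume forms on the tangent spaces which near each point are positive multiples of a form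
constant in the chart define an orientation. -/
lemma exists_isManifoldOrientation_of_volumeForm (hE : finrank ℝ E = 4)
    (θ : ∀ x : M, TangentSpace I x [⋀^Fin 4]→ₗ[ℝ] ℝ) (hθ : ∀ x, θ x ≠ 0)
    (h : ∀ p : M, ∀ᶠ x in 𝓝 p, ∃ c : ℝ, 0 < c ∧ ∀ w : Fin 4 → TangentSpace I x,
      θ x w = c * θ p (fun i => mfderiv I 𝓘(ℝ, E) (extChartAt I p) x (w i))) :
    ∃ o : ∀ x : M, Orientation ℝ (TangentSpace I x) (Fin 4), IsManifoldOrientation o := by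
  refine ⟨fun x => rayOfNeZero ℝ (θ x) (hθ x), fun p => ?_⟩
  filter_upwards [h p] with x ⟨c, hc, hx⟩ w
  have h1 := isPositiveFrame_rayOfNeZero_iff (V := E) hE (hθ x) w
  have h2 := isPositiveFrame_rayOfNeZero_iff (V := E) hE (hθ p)
    (fun i => mfderiv I 𝓘(ℝ, E) (extChartAt I p) x (w i))
  refine h1.trans (Iff.trans ?_ h2.symm)
  exact (iff_of_eq (congrArg (0 < ·) (hx w))).trans (mul_pos_iff_of_pos_left hc)

lemma continuous_basis_det {W : Type*} [NormedAddCommGroup W] [NormedSpace ℝ W]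
    [FiniteDimensional ℝ W] {k : ℕ} (b : Basis (Fin k) ℝ W) : Continuous fun v => b.det v := by
  simp only [Basis.det_apply]
  refine Continuous.matrix_det (continuous_matrix fun i j => ?_)
  exact (b.coord i).continuous_of_finiteDimensional.comp (continuous_apply j)

/-- The differential at `x` of a vector-valued map, read in the chart at `p`. -/
lemma mfderiv_eq_fderiv_comp_mfderiv_extChartAt [I.Boundaryless] [IsManifold I ∞ M]
    {W : Type*} [NormedAddCommGroup W] [NormedSpace ℝ W] {f : M → W}
    (hf : ContMDiff I 𝓘(ℝ, W) ∞ f) {p x : M} (hx : x ∈ (extChartAt I p).source)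
    (v : TangentSpace I x) :
    mfderiv I 𝓘(ℝ, W) f x v =
      fderiv ℝ (f ∘ (extChartAt I p).symm) (extChartAt I p x)
        (mfderiv I 𝓘(ℝ, E) (extChartAt I p) x v) := by
  have hΨ : ContMDiffOn 𝓘(ℝ, E) 𝓘(ℝ, W) ∞ (f ∘ (extChartAt I p).symm) (extChartAt I p).target :=
    hf.comp_contMDiffOn (contMDiffOn_extChartAt_symm p)
  have hy : (extChartAt I p).target ∈ 𝓝 (extChartAt I p x) :=
    (isOpen_extChartAt_target p).mem_nhds ((extChartAt I p).map_source hx)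
  have h1 : MDifferentiableAt 𝓘(ℝ, E) 𝓘(ℝ, W) (f ∘ (extChartAt I p).symm) (extChartAt I p x) :=
    (hΨ.contMDiffAt hy).mdifferentiableAt (by simp)
  have h2 : MDifferentiableAt I 𝓘(ℝ, E) (extChartAt I p) x :=
    mdifferentiableAt_extChartAt (by rwa [extChartAt_source] at hx)
  have h3 : f =ᶠ[𝓝 x] (f ∘ (extChartAt I p).symm) ∘ extChartAt I p := by
    filter_upwards [(isOpen_extChartAt_source p).mem_nhds hx] with z hz
    exact congrArg f ((extChartAt I p).left_inv hz).symm
  have h4 := mfderiv_comp x h1 h2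
  have h5 : mfderiv I 𝓘(ℝ, W) f x = _ := h3.mfderiv_eq.trans h4
  rw [mfderiv_eq_fderiv] at h5
  exact congrArg (fun L : E →L[ℝ] W => L v) h5

/-- Contraction of a volume form on a 6-dimensional space with two vectors. -/
lemma exists_contracted_volumeForm {W : Type*} [NormedAddCommGroup W] [NormedSpace ℝ W]
    [FiniteDimensional ℝ W] (hW : finrank ℝ W = 4 + 1 + 1) :
    ∃ η : W → W → W [⋀^Fin 4]→ₗ[ℝ] ℝ,
      (Continuous fun z : W × W × (Fin 4 → W) => η z.1 z.2.1 z.2.2) ∧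
      ∀ u v w, LinearIndependent ℝ (Matrix.vecCons u (Matrix.vecCons v w)) → η u v w ≠ 0 := by
  let D : Basis (Fin (4 + 1 + 1)) ℝ W := finBasisOfFinrankEq ℝ W hW
  have hη : ∀ u v w, (D.det.curryLeft u).curryLeft v w =
      D.det (Matrix.vecCons u (Matrix.vecCons v w)) := fun u v w => by
    rw [AlternatingMap.curryLeft_apply_apply, AlternatingMap.curryLeft_apply_apply]
  refine ⟨fun u v => (D.det.curryLeft u).curryLeft v, ?_, fun u v w hli => ?_⟩
  · simp only [hη]
    refine (continuous_basis_det D).comp (continuous_pi fun i => ?_)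
    refine Fin.cases continuous_fst (fun i => ?_) i
    refine Fin.cases (continuous_fst.comp continuous_snd) (fun i => ?_) i
    exact (continuous_apply i).comp (continuous_snd.comp continuous_snd)
  · rw [hη]
    have hB := D.det.map_basis_ne_zero_iff (basisOfLinearIndependentOfCardEqFinrank hli
      (by simp [hW]))
    rw [coe_basisOfLinearIndependentOfCardEqFinrank] at hB
    exact hB.2 D.det_ne_zero

/-- Top-degree forms are proportional. -/
lemma AlternatingMap.apply_eq_div_mul {V : Type*} [AddCommGroup V] [Module ℝ V] {k : ℕ}
    (b : Basis (Fin k) ℝ V) (α β : V [⋀^Fin k]→ₗ[ℝ] ℝ) (h : β b ≠ 0) (w : Fin k → V) :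
    α w = α b / β b * β w := by
  have h₁ : α w = α b * b.det w := DFunLike.congr_fun (α.eq_smul_basis_det b) w
  have h₂ : β w = β b * b.det w := DFunLike.congr_fun (β.eq_smul_basis_det b) w
  rw [h₁, h₂]
  field_simp

/-- A 4-manifold immersed in a 6-dimensional vector space with a transverse frame `ν₁`, `ν₂` is
orientable: the contraction of a volume form with the frame restricts to a volume form. -/
lemma exists_isManifoldOrientation_of_transverse_frame [I.Boundaryless] [IsManifold I ∞ M]
    (hE : finrank ℝ E = 4) {W : Type*} [NormedAddCommGroup W] [NormedSpace ℝ W]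
    [FiniteDimensional ℝ W] (hW : finrank ℝ W = 6) {f ν₁ ν₂ : M → W}
    (hf : ContMDiff I 𝓘(ℝ, W) ∞ f) (h₁ : Continuous ν₁) (h₂ : Continuous ν₂)
    (hinj : ∀ x, Function.Injective (mfderiv I 𝓘(ℝ, W) f x))
    (ht : ∀ x, ∃ ℓ₁ ℓ₂ : W →ₗ[ℝ] ℝ, (∀ v, ℓ₁ (mfderiv I 𝓘(ℝ, W) f x v) = 0) ∧
      (∀ v, ℓ₂ (mfderiv I 𝓘(ℝ, W) f x v) = 0) ∧
      ℓ₁ (ν₁ x) ≠ 0 ∧ ℓ₁ (ν₂ x) = 0 ∧ ℓ₂ (ν₂ x) ≠ 0) :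
    ∃ o : ∀ x : M, Orientation ℝ (TangentSpace I x) (Fin 4), IsManifoldOrientation o := by
  let b : Basis (Fin 4) ℝ E := finBasisOfFinrankEq ℝ E hE
  obtain ⟨η, hηc, hη⟩ := exists_contracted_volumeForm hW
  let df : M → E →L[ℝ] W := fun x => mfderiv I 𝓘(ℝ, W) f x
  let θ : M → E [⋀^Fin 4]→ₗ[ℝ] ℝ := fun x => (η (ν₁ x) (ν₂ x)).compLinearMap (df x).toLinearMap
  have hθb : ∀ x, θ x b ≠ 0 := by
    intro x
    obtain ⟨ℓ₁, ℓ₂, k1, k2, k3, k4, k5⟩ := ht x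
    refine hη (ν₁ x) (ν₂ x) (fun i => df x (b i)) ?_
    have hspan : ∀ (ℓ : W →ₗ[ℝ] ℝ) {k : ℕ} (s : Fin k → W), (∀ i, ℓ (s i) = 0) →
        ∀ z, ℓ z ≠ 0 → z ∉ Submodule.span ℝ (Set.range s) := by
      intro ℓ k s hs z hz hmem
      have : Submodule.span ℝ (Set.range s) ≤ LinearMap.ker ℓ := by
        rw [Submodule.span_le]
        rintro _ ⟨i, rfl⟩
        exact hs i
      exact hz (this hmem)
    refine linearIndependent_finCons.2 ⟨linearIndependent_finCons.2 ⟨?_, ?_⟩, ?_⟩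
    · exact b.linearIndependent.map' (df x).toLinearMap (LinearMap.ker_eq_bot.2 (hinj x))
    · exact hspan ℓ₂ _ (fun i => k2 _) _ k5
    · refine hspan ℓ₁ _ (fun i => ?_) _ k3
      refine Fin.cases ?_ (fun j => ?_) i
      · exact k4
      · exact k1 _
  refine exists_isManifoldOrientation_of_volumeForm hE θ
    (fun x h => hθb x (by rw [h]; rfl)) fun p => ?_
  let Ψ : E → W := f ∘ (extChartAt I p).symm
  -- `Ω x` is the form `θ x`, transported to the tangent space at `p` by the chart at `p`.
  let Ω : M → E [⋀^Fin 4]→ₗ[ℝ] ℝ := fun x =>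
    (η (ν₁ x) (ν₂ x)).compLinearMap (fderiv ℝ Ψ (extChartAt I p x)).toLinearMap
  have hΩp : Ω p = θ p := by
    have h : df p = fderiv ℝ Ψ (extChartAt I p p) :=
      mfderiv_eq_fderiv_comp_extChartAt_symm (hf.mdifferentiable (by simp) p)
    simp only [Ω, θ, h]
  have hcont : ContinuousAt (fun x => Ω x b / θ p b) p := by
    refine ContinuousAt.div_const ?_ _
    have hΨ : ContDiffOn ℝ ∞ Ψ (extChartAt I p).target :=
      contMDiffOn_iff_contDiffOn.1 (hf.comp_contMDiffOn (contMDiffOn_extChartAt_symm p))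
    have hd : ContinuousAt (fun x => fderiv ℝ Ψ (extChartAt I p x)) p := by
      refine ContinuousAt.comp (f := extChartAt I p) (g := fderiv ℝ Ψ) ?_
        (continuousAt_extChartAt p)
      exact (hΨ.continuousOn_fderiv_of_isOpen (isOpen_extChartAt_target p) (by simp)).continuousAt
        ((isOpen_extChartAt_target p).mem_nhds (mem_extChartAt_target p))
    have hz : ContinuousAt (fun x => (ν₁ x, ν₂ x, fun i => fderiv ℝ Ψ (extChartAt I p x) (b i))) p :=
      h₁.continuousAt.prodMk (h₂.continuousAt.prodMk
        (continuousAt_pi.2 fun i => hd.clm_apply continuousAt_const))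
    exact hηc.continuousAt.comp hz
  have hpos : ∀ᶠ x in 𝓝 p, 0 < Ω x b / θ p b := by
    refine hcont.eventually (lt_mem_nhds ?_)
    change 0 < Ω p b / θ p b
    rw [hΩp, div_self (hθb p)]
    exact one_pos
  filter_upwards [hpos, (isOpen_extChartAt_source p).mem_nhds (mem_extChartAt_source (I := I) p)]
    with x hx hxs
  refine ⟨_, hx, fun w => ?_⟩
  have h1 : θ x w = Ω x fun i => mfderiv I 𝓘(ℝ, E) (extChartAt I p) x (w i) :=
    congrArg (η (ν₁ x) (ν₂ x)) (funext fun i =>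
      mfderiv_eq_fderiv_comp_mfderiv_extChartAt hf hxs (w i))
  exact h1.trans (AlternatingMap.apply_eq_div_mul b (Ω x) (θ p) (hθb p) _)

/-- The outward normals of the two factors frame the normal bundle of `S¹ × S³ ⊂ ℝ² × ℝ⁴`. -/
lemma exists_isManifoldOrientation_S1S3 :
    ∃ o : ∀ x : Sph 1 × Sph 3, Orientation ℝ (TangentSpace ((𝓡 1).prod (𝓡 3)) x) (Fin 4),
      IsManifoldOrientation o := by
  let f : Sph 1 × Sph 3 → EuclideanSpace ℝ (Fin (1 + 1)) × EuclideanSpace ℝ (Fin (3 + 1)) :=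
    fun x => (Sph.incl 1 x.1, Sph.incl 3 x.2)
  have hf : ContMDiff ((𝓡 1).prod (𝓡 3))
      𝓘(ℝ, EuclideanSpace ℝ (Fin (1 + 1)) × EuclideanSpace ℝ (Fin (3 + 1))) ∞ f :=
    ((Sph.incl_contMDiff 1).comp contMDiff_fst).prodMk_space
      ((Sph.incl_contMDiff 3).comp contMDiff_snd)
  have hdf : ∀ (x : Sph 1 × Sph 3) (v : EuclideanSpace ℝ (Fin 1) × EuclideanSpace ℝ (Fin 3)),
      mfderiv ((𝓡 1).prod (𝓡 3))
        𝓘(ℝ, EuclideanSpace ℝ (Fin (1 + 1)) × EuclideanSpace ℝ (Fin (3 + 1))) f x v =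
      (fderiv ℝ (sphereParam x.1) 0 v.1, fderiv ℝ (sphereParam x.2) 0 v.2) := by
    intro x v
    have h := mfderiv_eq_fderiv_comp_extChartAt_symm (hf.mdifferentiable (by simp) x)
    rw [extChartAt_prod_sphere_self] at h
    have d1 := ((contDiff_sphereParam x.1).differentiable (by simp) 0).hasFDerivAt.comp
      (0 : EuclideanSpace ℝ (Fin 1) × EuclideanSpace ℝ (Fin 3))
      (hasFDerivAt_fst (𝕜 := ℝ) (p := 0))
    have d2 := ((contDiff_sphereParam x.2).differentiable (by simp) 0).hasFDerivAt.comp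
      (0 : EuclideanSpace ℝ (Fin 1) × EuclideanSpace ℝ (Fin 3))
      (hasFDerivAt_snd (𝕜 := ℝ) (p := 0))
    have d := (d1.prodMk d2).fderiv
    exact congrArg (fun L : (EuclideanSpace ℝ (Fin 1) × EuclideanSpace ℝ (Fin 3)) →L[ℝ]
      (EuclideanSpace ℝ (Fin (1 + 1)) × EuclideanSpace ℝ (Fin (3 + 1))) => L v) (h.trans d)
  have hne : ∀ {n : ℕ} (x : Sph n), (inner ℝ (x : EuclideanSpace ℝ (Fin (n + 1)))
      (x : EuclideanSpace ℝ (Fin (n + 1))) : ℝ) ≠ 0 := fun x => by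
    rw [real_inner_self_eq_norm_sq, norm_eq_of_mem_sphere]
    norm_num
  refine exists_isManifoldOrientation_of_transverse_frame (by simp) (by simp) hf
    (ν₁ := fun x => ((x.1 : EuclideanSpace ℝ (Fin (1 + 1))), 0))
    (ν₂ := fun x => (0, (x.2 : EuclideanSpace ℝ (Fin (3 + 1))))) (by fun_prop) (by fun_prop)
    (fun x v w hvw => ?_) fun x => ?_
  · have h := ((hdf x v).symm.trans hvw).trans (hdf x w)
    exact Prod.ext (fderiv_sphereParam_zero_injective x.1 (congrArg Prod.fst h))
      (fderiv_sphereParam_zero_injective x.2 (congrArg Prod.snd h))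
  · refine ⟨(innerₗ _ (x.1 : EuclideanSpace ℝ (Fin (1 + 1)))).comp (LinearMap.fst ℝ _ _),
      (innerₗ _ (x.2 : EuclideanSpace ℝ (Fin (3 + 1)))).comp (LinearMap.snd ℝ _ _),
      fun v => ?_, fun v => ?_, hne x.1, ?_, hne x.2⟩
    · refine (congrArg (fun z : EuclideanSpace ℝ (Fin (1 + 1)) × EuclideanSpace ℝ (Fin (3 + 1)) =>
        (inner ℝ (x.1 : EuclideanSpace ℝ (Fin (1 + 1))) z.1 : ℝ)) (hdf x v)).trans ?_
      exact (real_inner_comm _ _).trans (inner_fderiv_sphereParam_zero x.1 _)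
    · refine (congrArg (fun z : EuclideanSpace ℝ (Fin (1 + 1)) × EuclideanSpace ℝ (Fin (3 + 1)) =>
        (inner ℝ (x.2 : EuclideanSpace ℝ (Fin (3 + 1))) z.2 : ℝ)) (hdf x v)).trans ?_
      exact (real_inner_comm _ _).trans (inner_fderiv_sphereParam_zero x.2 _)
    · simp

end Orientability

theorem mainTheorem9 :
    IsLocallyConformallyFlat metricS1S3 ∧
    ((∃ o : ∀ x : Sph 1 × Sph 3, Orientation ℝ (TangentSpace ((𝓡 1).prod (𝓡 3)) x) (Fin 4),
        IsManifoldOrientation o) ∧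
      ∀ o : ∀ x : Sph 1 × Sph 3, Orientation ℝ (TangentSpace ((𝓡 1).prod (𝓡 3)) x) (Fin 4),
        IsManifoldOrientation o → IsSelfDual metricS1S3 o) ∧
    (∀ (x : Sph 1 × Sph 3) (X Y Z T : TangentSpace ((𝓡 1).prod (𝓡 3)) x),
      riemannTensor metricS1S3.inner x X Y Z T =
        kulkarniNomizu (fun u v => metricS1S3.inner x u v)
          (fun u v => (tensorS3 x u v - dxSquared x u v) / 2) X Y Z T) ∧
    (∀ (x : Sph 1 × Sph 3) (X Y Z T : TangentSpace ((𝓡 1).prod (𝓡 3)) x),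
      weylTensor metricS1S3.inner x X Y Z T = 0) :=
  ⟨isLocallyConformallyFlat_metricS1S3,
    ⟨exists_isManifoldOrientation_S1S3,
      fun o _ => isSelfDual_of_weylTensor_eq_zero weylTensor_metricS1S3 o⟩,
    riemannTensor_metricS1S3_eq_kulkarniNomizu, weylTensor_metricS1S3⟩
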